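/- Let $\xi$ be a complex random variable that is sub-Gaussian (that is, there are constants $c_0,C_0>0$ with $\mathbb{P}[|\xi|>t]\le C_0e^{-c_0t^2}$ for all $t\ge 0$) and has a density with respect to Lebesgue measure on $\mathbb{C}\cong\mathbb{R}^2$ bounded by $K$. Let $G_n$ be a random $n\times n$ matrix such that the entries of $n^{1/2}G_n$ are independent copies of $\xi$. For $M\in\mathbb{C}^{n\times n}$ let $\|M\|$ be the $\ell^2\to\ell^2$ operator norm and $\eta(M):=\min_{i\ne j}|\lambda_i-\lambda_j|$, where $\lambda_1,\dots,\lambda_n$ are the eigenvalues of $M$ counted with multiplicity ($\eta(M)=+\infty$ if $n\le 1$). Theorem. There is an absolute constant $c>0$ such that for every such $\xi$, $K$, $n$ and $G_n$, every $A\in\mathbb{C}^{n\times n}$ with $\|A\|\le 1$, every $\delta\in(0,1)$, every $K'\ge 0$ and every $s\in(0,1]$, $$\mathbb{P}\big[\|G_n\|\le K'\ \text{ and }\ \eta(A+\delta G_n)\le s\big]\le c\,\log_2\!\Big(\frac{2(1+\delta K')}{s}\Big)(1+\delta K')^2K^2n^6\frac{s^2}{\delta^4}.$$ -/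

import Mathlib

open MeasureTheory ProbabilityTheory
open scoped ENNReal Matrix.Norms.L2Operator

/-- A complex random variable is sub-Gaussian if its tails satisfy
`P[|X| > t] ≤ C exp(-c t²)` for all `t ≥ 0`, for some constants `c, C > 0`. -/
def IsSubGaussian {Ω : Type*} [MeasurableSpace Ω] (X : Ω → ℂ) (P : Measure Ω) : Prop :=
  ∃ c C : ℝ, 0 < c ∧ 0 < C ∧
    ∀ t : ℝ, 0 ≤ t → P.real {ω | t < ‖X ω‖} ≤ C * Real.exp (-c * t ^ 2)

/-- `X` has a density with respect to Lebesgue measure on `ℂ = ℝ²` that is bounded by `K`. -/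
def HasDensityBoundedBy {Ω : Type*} [MeasurableSpace Ω] (X : Ω → ℂ) (P : Measure Ω)
    (K : ℝ) : Prop :=
  AEMeasurable X P ∧ ∃ f : ℂ → ℝ, Measurable f ∧ (∀ z, 0 ≤ f z ∧ f z ≤ K) ∧
    P.map X = (volume : Measure ℂ).withDensity (fun z => ENNReal.ofReal (f z))

/-- `G` is a random matrix `G_n(ξ)`: the entries of `n^{1/2} G` are independent copies of `ξ`. -/
def IsNormalizedIIDMatrix {Ω Ω' : Type*} [MeasurableSpace Ω] [MeasurableSpace Ω'] {n : ℕ}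
    (G : Ω → Matrix (Fin n) (Fin n) ℂ) (P : Measure Ω) (ξ : Ω' → ℂ) (P' : Measure Ω') : Prop :=
  iIndepFun (fun (p : Fin n × Fin n) (ω : Ω) => (Real.sqrt n : ℂ) * G ω p.1 p.2) P ∧
    ∀ p : Fin n × Fin n,
      IdentDistrib (fun ω : Ω => (Real.sqrt n : ℂ) * G ω p.1 p.2) ξ P P'

/-- The minimum eigenvalue gap `η(M) = min_{i ≠ j} |λ_i - λ_j|`, where the eigenvalues are the
roots of the characteristic polynomial counted with multiplicity: the pair `(a, b)` ranges over
the two-element sub-multisets of the multiset of eigenvalues, so `a = b` is allowed exactly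
for an eigenvalue of multiplicity at least two. It is `⊤` if there are fewer than two eigenvalues
(`n ≤ 1`). -/
noncomputable def eigenvalueGap {n : ℕ} (M : Matrix (Fin n) (Fin n) ℂ) : ℝ≥0∞ :=
  ⨅ (a : ℂ) (b : ℂ) (_ : ({a, b} : Multiset ℂ) ≤ M.charpoly.roots), edist a b

/-! Write M = A + δG and R = 1 + δK', so that ‖M‖ ≤ R on the event in question. If two eigenvalues
of M are O(s)-close, some z in the lattice sℤ[i] is within O(s) of both, and the union over the
O((R/s)²) relevant z costs R²/s². It remains to show that for fixed z, having two eigenvalues within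
O(s) of z has probability O(s⁴), up to the logarithm and the other parameters.

Linear algebra: a pair of eigenvalues gives orthonormal w₁, w₂ on which M - z is upper triangular
with diagonal entries of size O(s), hence determinant O(s²), whatever the off-diagonal entry. Some
2×2 minor of (w₁, w₂), on rows i ≠ j, has modulus at least 1/n. Projecting away the other columns of
M - z and comparing Gram determinants gives d₁d₂ = O(ns²), where d₁ is the distance of column i to
the span of the columns other than i and j, and d₂ that of column j to the span of all other columns
(`exists_columns_of_triangular_pair`).

Probability: given the other columns, being within r of their span forces a linear form with unit
coefficients in n independent copies of ξ into a disc of radius r√n/δ. Such a form has small ball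
probabilities O(K · radius²), with no dependence on n (`pi_ball_le`). The event for d₁ does not
involve column j, so the two bounds multiply. Cutting d₁ into O(log(2R/s)) dyadic ranges, each of
probability O(K²(ns²)²n²/δ⁴), gives the logarithm. With n² pairs (i, j) the total is the stated
bound.

The small ball estimate is Fourier-analytic: bound the ball probability by the L¹ norm of the
characteristic function, a product over coordinates, and apply Hölder with weights ‖v k‖². This
needs the decay 1/q of high moments of the characteristic function (`lintegral_charFun_rpow_le`). If
one coordinate carries more than half the mass, its density alone suffices. -/

/-! ### Characteristic functions of planar measures with bounded density -/

section Fourier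

open Complex in
/-- Parseval identity between a finite measure on `ℂ` and a modulated Gaussian. -/
lemma integral_gaussian_mul_charFun (ρ : Measure ℂ) [IsProbabilityMeasure ρ] {b : ℝ} (hb : 0 < b)
    (c : ℂ) :
    ∫ ξ : ℂ, cexp (-b * ‖ξ‖ ^ 2) * cexp (-((inner ℝ c ξ : ℝ) : ℂ) * I) * charFun ρ ξ =
      (Real.pi / b : ℂ) * ∫ x, cexp (-(‖x - c‖ ^ 2 / (4 * b) : ℝ)) ∂ρ := by
  have hb' : 0 < (b : ℂ).re := by simpa using hb
  have h1 : ∀ ξ : ℂ, cexp (-b * ‖ξ‖ ^ 2) * cexp (-((inner ℝ c ξ : ℝ) : ℂ) * I) * charFun ρ ξ =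
      ∫ x, cexp (-b * ‖ξ‖ ^ 2 + I * ((inner ℝ (x - c) ξ : ℝ) : ℂ)) ∂ρ := by
    intro ξ
    rw [charFun_apply, ← integral_const_mul]
    congr 1
    ext x
    rw [← Complex.exp_add, ← Complex.exp_add, inner_sub_left]
    congr 1
    push_cast
    ring
  simp_rw [h1]
  rw [integral_integral_swap]
  · rw [← integral_const_mul]
    congr 1
    ext x
    rw [GaussianFourier.integral_cexp_neg_mul_sq_norm_add hb' I (x - c)]
    simp only [Complex.finrank_real_complex]
    norm_num
    left
    congr 1
    ring
  · have hint : Integrable (fun ξ : ℂ => cexp (-b * ‖ξ‖ ^ 2)) := by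
      simpa using GaussianFourier.integrable_cexp_neg_mul_sq_norm_add hb' 0 (0 : ℂ)
    refine (hint.norm.comp_fst ρ).mono' ?_ ?_
    · apply Continuous.aestronglyMeasurable
      simp only [Function.uncurry_def]
      fun_prop
    · refine Filter.Eventually.of_forall fun p => ?_
      simp only [Function.uncurry_def]
      rw [Complex.exp_add, norm_mul, mul_comm I, Complex.norm_exp_ofReal_mul_I, mul_one]

/-- Esseen-type inequality: small ball probabilities are controlled by the `L¹` norm of the
characteristic function. -/
lemma measure_ball_le_lintegral_charFun (ρ : Measure ℂ) [IsProbabilityMeasure ρ] (c : ℂ) {r : ℝ}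
    (hr : 0 < r) :
    ρ (Metric.ball c r) ≤ ENNReal.ofReal (r ^ 2) * ∫⁻ ξ : ℂ, ‖charFun ρ ξ‖ₑ := by
  -- With this `b` the Gaussian is exp(-‖x - c‖²/r²), at least 1/e on the ball, while π/b = 4π/r²
  -- supplies the factor r².
  set b : ℝ := r ^ 2 / 4 with hbdef
  have hb : 0 < b := by positivity
  have key := integral_gaussian_mul_charFun ρ hb c
  have hint : Integrable (fun x : ℂ => Real.exp (-(‖x - c‖ ^ 2 / (4 * b)))) ρ := by
    refine Integrable.mono' (integrable_const (1 : ℝ)) ?_ ?_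
    · exact Continuous.aestronglyMeasurable (by fun_prop)
    · refine Filter.Eventually.of_forall fun x => ?_
      rw [Real.norm_eq_abs, abs_of_pos (Real.exp_pos _), Real.exp_le_one_iff]
      have : 0 ≤ ‖x - c‖ ^ 2 / (4 * b) := by positivity
      linarith
  have h1 : ∫ x, Complex.exp (-(‖x - c‖ ^ 2 / (4 * b) : ℝ)) ∂ρ =
      ((∫ x, Real.exp (-(‖x - c‖ ^ 2 / (4 * b))) ∂ρ : ℝ) : ℂ) := by
    rw [← integral_complex_ofReal]
    congr 1
    ext x
    push_cast
    rfl
  rw [h1] at key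
  set J := ∫ x, Real.exp (-(‖x - c‖ ^ 2 / (4 * b))) ∂ρ
  have hJ0 : 0 ≤ J := integral_nonneg fun x => (Real.exp_pos _).le
  have h2 : ENNReal.ofReal (Real.pi / b * J) ≤ ∫⁻ ξ : ℂ, ‖charFun ρ ξ‖ₑ := by
    have : ENNReal.ofReal (Real.pi / b * J) = ‖(Real.pi / b : ℂ) * (J : ℂ)‖ₑ := by
      rw [← ofReal_norm]
      congr 1
      have : ((Real.pi / b : ℂ) * (J : ℂ)) = ((Real.pi / b * J : ℝ) : ℂ) := by push_cast; rfl
      rw [this, Complex.norm_real, Real.norm_of_nonneg]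
      have := Real.pi_pos
      positivity
    rw [this, ← key]
    refine (enorm_integral_le_lintegral_enorm _).trans (lintegral_mono fun ξ => ?_)
    rw [enorm_mul, enorm_mul]
    have e1 : ‖Complex.exp (-((inner ℝ c ξ : ℝ) : ℂ) * Complex.I)‖ₑ = 1 := by
      rw [← ofReal_norm, ← Complex.ofReal_neg, Complex.norm_exp_ofReal_mul_I]
      simp
    have e2 : ‖Complex.exp (-(b : ℂ) * (‖ξ‖ : ℂ) ^ 2)‖ₑ ≤ 1 := by
      rw [← ofReal_norm, Complex.norm_exp]
      have : (-(b : ℂ) * (‖ξ‖ : ℂ) ^ 2).re = -(b * ‖ξ‖ ^ 2) := by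
        rw [← Complex.ofReal_pow, ← Complex.ofReal_neg, ← Complex.ofReal_mul, Complex.ofReal_re]
        ring
      rw [this]
      refine ENNReal.ofReal_le_one.2 (Real.exp_le_one_iff.2 ?_)
      have : 0 ≤ b * ‖ξ‖ ^ 2 := by positivity
      linarith
    rw [e1, mul_one]
    calc _ ≤ 1 * ‖charFun ρ ξ‖ₑ := by gcongr
      _ = _ := one_mul _
  have h3 : ρ.real (Metric.ball c r) * Real.exp (-1) ≤ J := by
    have : ρ.real (Metric.ball c r) * Real.exp (-1) =
        ∫ x, (Metric.ball c r).indicator (fun _ => Real.exp (-1)) x ∂ρ := by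
      rw [integral_indicator_const _ Metric.isOpen_ball.measurableSet, smul_eq_mul]
    rw [this]
    refine integral_mono ((integrable_const _).indicator Metric.isOpen_ball.measurableSet) hint ?_
    intro x
    by_cases hx : x ∈ Metric.ball c r
    · rw [Set.indicator_of_mem hx]
      refine Real.exp_le_exp.2 (neg_le_neg ?_)
      rw [div_le_one (by positivity), hbdef]
      rw [Metric.mem_ball, dist_eq_norm] at hx
      have := norm_nonneg (x - c)
      nlinarith
    · rw [Set.indicator_of_notMem hx]
      exact (Real.exp_pos _).le
  have h4 : ρ.real (Metric.ball c r) ≤ r ^ 2 * (Real.pi / b * J) := by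
    have hpi := Real.pi_gt_three
    have e : r ^ 2 * (Real.pi / b * J) = 4 * Real.pi * J := by
      rw [hbdef]; field_simp
    rw [e]
    have h5 : Real.exp (-1) ≥ 1 / 4 := by
      rw [Real.exp_neg, ge_iff_le, one_div]
      gcongr
      have := Real.exp_one_lt_d9
      linarith
    have : 0 ≤ ρ.real (Metric.ball c r) := measureReal_nonneg
    nlinarith
  calc ρ (Metric.ball c r) = ENNReal.ofReal (ρ.real (Metric.ball c r)) := by
        rw [ofReal_measureReal]
    _ ≤ ENNReal.ofReal (r ^ 2 * (Real.pi / b * J)) := ENNReal.ofReal_le_ofReal h4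
    _ = ENNReal.ofReal (r ^ 2) * ENNReal.ofReal (Real.pi / b * J) :=
        ENNReal.ofReal_mul (by positivity)
    _ ≤ _ := by gcongr

/-- If the characteristic function is real and nonnegative and the measure has density at most
`K`, then the characteristic function is integrable, with integral at most `4π²K`. -/
lemma lintegral_charFun_le_of_nonneg (ρ : Measure ℂ) [IsProbabilityMeasure ρ] {K : ℝ≥0∞}
    (hρ : ρ ≤ K • volume) (h : ℂ → ℝ) (h0 : ∀ ξ, 0 ≤ h ξ) (hh : ∀ ξ, charFun ρ ξ = h ξ) :
    ∫⁻ ξ, ENNReal.ofReal (h ξ) ≤ K * ENNReal.ofReal (4 * Real.pi ^ 2) := by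
  have hpi := Real.pi_pos
  have hm : Measurable h := by
    have : h = fun ξ => (charFun ρ ξ).re := by ext ξ; simp [hh]
    rw [this]
    exact Complex.measurable_re.comp measurable_charFun
  have hle : ∀ ξ, h ξ ≤ 1 := fun ξ => by
    have := norm_charFun_le_one (μ := ρ) ξ
    rw [hh, Complex.norm_real, Real.norm_of_nonneg (h0 ξ)] at this
    exact this
  -- Gaussian damping makes Parseval applicable. Its factor π/b cancels against the mass 4πb of the
  -- dual Gaussian, so the bound is uniform in `b` and survives monotone convergence as b → 0.
  have step : ∀ b : ℝ, 0 < b → ∫⁻ ξ, ENNReal.ofReal (Real.exp (-b * ‖ξ‖ ^ 2) * h ξ) ≤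
      K * ENNReal.ofReal (4 * Real.pi ^ 2) := by
    intro b hb
    have key := integral_gaussian_mul_charFun ρ hb 0
    have hgint : ∀ a : ℝ, 0 < a → Integrable (fun ξ : ℂ => Real.exp (-a * ‖ξ‖ ^ 2)) := by
      intro a ha
      have := (GaussianFourier.integrable_cexp_neg_mul_sq_norm_add (b := (a : ℂ)) (by simpa)
        0 (0 : ℂ)).norm
      refine this.congr (Filter.Eventually.of_forall fun ξ => ?_)
      simp only [Complex.norm_exp]
      norm_cast
      simp
    have hint : Integrable (fun ξ : ℂ => Real.exp (-b * ‖ξ‖ ^ 2) * h ξ) := by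
      refine (hgint b hb).mono' (by fun_prop) (Filter.Eventually.of_forall fun ξ => ?_)
      rw [norm_mul, Real.norm_of_nonneg (Real.exp_pos _).le, Real.norm_of_nonneg (h0 ξ)]
      exact mul_le_of_le_one_right (Real.exp_pos _).le (hle ξ)
    have hint2 : Integrable (fun x : ℂ => Real.exp (-(1 / (4 * b)) * ‖x‖ ^ 2)) ρ := by
      refine Integrable.mono' (integrable_const (1 : ℝ)) (by fun_prop) ?_
      refine Filter.Eventually.of_forall fun x => ?_
      rw [Real.norm_of_nonneg (Real.exp_pos _).le, Real.exp_le_one_iff, neg_mul, neg_nonpos]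
      positivity
    have key2 : ∫ ξ : ℂ, Real.exp (-b * ‖ξ‖ ^ 2) * h ξ =
        Real.pi / b * ∫ x, Real.exp (-(1 / (4 * b)) * ‖x‖ ^ 2) ∂ρ := by
      apply Complex.ofReal_injective
      have hA : ∫ ξ : ℂ, ((Real.exp (-b * ‖ξ‖ ^ 2) * h ξ : ℝ) : ℂ) =
          ∫ ξ : ℂ, Complex.exp (-b * ‖ξ‖ ^ 2) *
            Complex.exp (-((inner ℝ 0 ξ : ℝ) : ℂ) * Complex.I) * charFun ρ ξ :=
        integral_congr_ae (Filter.Eventually.of_forall fun ξ => by simp [hh])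
      have hB : ∫ x : ℂ, ((Real.exp (-(1 / (4 * b)) * ‖x‖ ^ 2) : ℝ) : ℂ) ∂ρ =
          ∫ x : ℂ, Complex.exp (-(‖x - 0‖ ^ 2 / (4 * b) : ℝ)) ∂ρ :=
        integral_congr_ae (Filter.Eventually.of_forall fun x => by
          dsimp only
          rw [sub_zero]
          push_cast
          congr 1
          ring)
      rw [Complex.ofReal_mul, ← integral_complex_ofReal, ← integral_complex_ofReal, hA, hB, key]
      push_cast
      rfl
    rw [← ofReal_integral_eq_lintegral_ofReal hint
      (Filter.Eventually.of_forall fun ξ => mul_nonneg (Real.exp_pos _).le (h0 ξ)), key2,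
      ENNReal.ofReal_mul (by positivity), ofReal_integral_eq_lintegral_ofReal hint2
      (Filter.Eventually.of_forall fun ξ => (Real.exp_pos _).le)]
    have h4 : ∫⁻ x, ENNReal.ofReal (Real.exp (-(1 / (4 * b)) * ‖x‖ ^ 2)) ∂ρ ≤
        K * ENNReal.ofReal (4 * Real.pi * b) := by
      calc _ ≤ ∫⁻ x, ENNReal.ofReal (Real.exp (-(1 / (4 * b)) * ‖x‖ ^ 2)) ∂(K • volume) :=
            lintegral_mono' hρ le_rfl
        _ = K * ENNReal.ofReal (4 * Real.pi * b) := by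
            rw [lintegral_smul_measure, smul_eq_mul, ← ofReal_integral_eq_lintegral_ofReal
              (hgint _ (by positivity)) (Filter.Eventually.of_forall fun ξ => (Real.exp_pos _).le),
              GaussianFourier.integral_rexp_neg_mul_sq_norm (by positivity)]
            simp only [Complex.finrank_real_complex]
            norm_num
            congr 2
            field_simp
    calc _ ≤ ENNReal.ofReal (Real.pi / b) * (K * ENNReal.ofReal (4 * Real.pi * b)) := by gcongr
      _ = K * (ENNReal.ofReal (Real.pi / b) * ENNReal.ofReal (4 * Real.pi * b)) := by ring
      _ = K * ENNReal.ofReal (4 * Real.pi ^ 2) := by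
          rw [← ENNReal.ofReal_mul (by positivity)]
          congr 2
          field_simp
  refine le_of_tendsto' (lintegral_tendsto_of_tendsto_of_monotone
    (f := fun (m : ℕ) ξ => ENNReal.ofReal (Real.exp (-(1 / ((m : ℝ) + 1)) * ‖ξ‖ ^ 2) * h ξ))
    (fun m => by fun_prop) ?_ ?_) (fun m => step _ (by positivity))
  · refine Filter.Eventually.of_forall fun ξ m m' hmm' => ?_
    dsimp only
    gcongr
    exact h0 ξ
  · refine Filter.Eventually.of_forall fun ξ => ?_
    refine ENNReal.tendsto_ofReal ?_
    have h1 : Filter.Tendsto (fun m : ℕ => -(1 / ((m : ℝ) + 1)) * ‖ξ‖ ^ 2) Filter.atTop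
        (nhds (-0 * ‖ξ‖ ^ 2)) := (tendsto_one_div_add_atTop_nhds_zero_nat.neg).mul_const _
    have h2 := ((Real.continuous_exp.tendsto _).comp h1).mul_const (h ξ)
    simpa using h2

/-- The symmetrization of `μ`: the law of `X - X'` for independent copies `X`, `X'`. -/
noncomputable def symmetrization (μ : Measure ℂ) : Measure ℂ :=
  (μ.prod μ).map (fun p => p.1 - p.2)

instance (μ : Measure ℂ) [IsProbabilityMeasure μ] : IsProbabilityMeasure (symmetrization μ) :=
  Measure.isProbabilityMeasure_map (by fun_prop)

/-- Symmetrizing makes the characteristic function real and nonnegative, as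
`lintegral_charFun_le_of_nonneg` demands. -/
lemma charFun_symmetrization (μ : Measure ℂ) [IsProbabilityMeasure μ] (ξ : ℂ) :
    charFun (symmetrization μ) ξ = ((‖charFun μ ξ‖ ^ 2 : ℝ) : ℂ) := by
  rw [charFun_apply, symmetrization, integral_map (by fun_prop)
    (Continuous.aestronglyMeasurable (by fun_prop))]
  have h1 : ∀ p : ℂ × ℂ, Complex.exp (((inner ℝ (p.1 - p.2) ξ : ℝ) : ℂ) * Complex.I) =
      Complex.exp (((inner ℝ p.1 ξ : ℝ) : ℂ) * Complex.I) *
      Complex.exp (((inner ℝ p.2 (-ξ) : ℝ) : ℂ) * Complex.I) := by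
    intro p
    rw [← Complex.exp_add, inner_sub_left, inner_neg_right]
    congr 1
    push_cast
    ring
  simp_rw [h1]
  rw [integral_prod_mul (fun x : ℂ => Complex.exp (((inner ℝ x ξ : ℝ) : ℂ) * Complex.I))
    (fun x : ℂ => Complex.exp (((inner ℝ x (-ξ) : ℝ) : ℂ) * Complex.I)),
    ← charFun_apply, ← charFun_apply, charFun_neg, Complex.mul_conj, Complex.normSq_eq_norm_sq]

/-- Given X', the law of X - X' is a translate of `μ`, and Lebesgue measure is translation
invariant. -/
lemma symmetrization_le (μ : Measure ℂ) [IsProbabilityMeasure μ] {K : ℝ≥0∞}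
    (hμ : μ ≤ K • volume) : symmetrization μ ≤ K • volume := by
  refine Measure.le_intro fun S hS _ => ?_
  rw [symmetrization, Measure.map_apply (by fun_prop) hS,
    Measure.prod_apply_symm ((by fun_prop : Measurable fun p : ℂ × ℂ => p.1 - p.2) hS)]
  calc _ ≤ ∫⁻ _ : ℂ, K * volume S ∂μ := by
        refine lintegral_mono fun y => ?_
        refine (hμ _).trans ?_
        rw [Measure.smul_apply, smul_eq_mul]
        refine mul_le_mul_right (le_of_eq ?_) K
        have : (fun x => (x, y)) ⁻¹' ((fun p : ℂ × ℂ => p.1 - p.2) ⁻¹' S) =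
            (fun x => x - y) ⁻¹' S := rfl
        rw [this]
        simp_rw [sub_eq_add_neg]
        rw [measure_preimage_add_right]
    _ = (K • volume) S := by simp

/-- Doubling inequality for the defect of a squared characteristic function. -/
lemma one_sub_charFun_two_mul_le (μ : Measure ℂ) [IsProbabilityMeasure μ] (ξ : ℂ) :
    1 - ‖charFun μ ((2 : ℝ) • ξ)‖ ^ 2 ≤ 4 * (1 - ‖charFun μ ξ‖ ^ 2) := by
  have hcos : ∀ ζ : ℂ, Integrable (fun x : ℂ => Real.cos (inner ℝ x ζ)) (symmetrization μ) := by
    intro ζ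
    refine (integrable_const (1 : ℝ)).mono' (Continuous.aestronglyMeasurable (by fun_prop)) ?_
    exact Filter.Eventually.of_forall fun x => Real.abs_cos_le_one _
  have hre : ∀ ζ : ℂ, ‖charFun μ ζ‖ ^ 2 = ∫ x, Real.cos (inner ℝ x ζ) ∂(symmetrization μ) := by
    intro ζ
    have h := congrArg Complex.re (charFun_symmetrization μ ζ)
    rw [Complex.ofReal_re] at h
    rw [← h, charFun_apply, ← RCLike.re_eq_complex_re, ← integral_re]
    · congr 1
      ext x
      exact Complex.exp_ofReal_mul_I_re _
    · refine (integrable_const (1 : ℝ)).mono' (Continuous.aestronglyMeasurable (by fun_prop)) ?_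
      exact Filter.Eventually.of_forall fun x => (Complex.norm_exp_ofReal_mul_I _).le
  have hone : ∀ ζ : ℂ, 1 - ‖charFun μ ζ‖ ^ 2 =
      ∫ x, (1 - Real.cos (inner ℝ x ζ)) ∂(symmetrization μ) := by
    intro ζ
    rw [integral_sub (integrable_const _) (hcos ζ), hre]
    simp
  rw [hone, hone, ← integral_const_mul]
  refine integral_mono ((integrable_const _).sub (hcos _))
    (((integrable_const _).sub (hcos _)).const_mul _) fun x => ?_
  dsimp only
  rw [inner_smul_right, Real.cos_two_mul]
  -- The right side minus the left side equals 2(1 - cos)².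
  nlinarith [Real.cos_le_one (inner ℝ x ξ), sq_nonneg (Real.cos (inner ℝ x ξ) - 1)]

lemma lintegral_charFun_sq_le (μ : Measure ℂ) [IsProbabilityMeasure μ] {K : ℝ≥0∞}
    (hμ : μ ≤ K • volume) :
    ∫⁻ ξ, ENNReal.ofReal (‖charFun μ ξ‖ ^ 2) ≤ K * ENNReal.ofReal (4 * Real.pi ^ 2) :=
  lintegral_charFun_le_of_nonneg (symmetrization μ) (symmetrization_le μ hμ) _
    (fun ξ => by positivity) (charFun_symmetrization μ)

/-- The set where a characteristic function of a measure with density at most `K` is close to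
`1` in absolute value is small. -/
lemma volume_one_sub_charFun_le (μ : Measure ℂ) [IsProbabilityMeasure μ] {K : ℝ≥0∞}
    (hμ : μ ≤ K • volume) {η : ℝ} (hη0 : 0 < η) (hη : η ≤ 1 / 2) :
    volume {ξ | 1 - ‖charFun μ ξ‖ ^ 2 ≤ η} ≤
      ENNReal.ofReal η * (K * ENNReal.ofReal (64 * Real.pi ^ 2)) := by
  set N : ℝ → ℝ≥0∞ := fun t => volume {ξ : ℂ | 1 - ‖charFun μ ξ‖ ^ 2 ≤ t} with hN
  have hmeas : Measurable fun ξ => ‖charFun μ ξ‖ ^ 2 := by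
    have := measurable_charFun (μ := μ)
    fun_prop
  -- Doubling ξ multiplies the defect by at most 4 and planar area by exactly 4. Iterated, this
  -- shows that N decreases at least linearly towards 0.
  have hscale : ∀ t, 4 * N t ≤ N (4 * t) := by
    intro t
    have h1 : {ξ : ℂ | 1 - ‖charFun μ ξ‖ ^ 2 ≤ t} ⊆
        (fun ξ : ℂ => (2 : ℝ) • ξ) ⁻¹' {ξ : ℂ | 1 - ‖charFun μ ξ‖ ^ 2 ≤ 4 * t} := by
      intro ξ hξ
      simp only [Set.mem_ofPred_eq, Set.mem_preimage] at hξ ⊢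
      have := one_sub_charFun_two_mul_le μ ξ
      linarith
    have h2 := measure_mono (μ := volume) h1
    rw [Measure.addHaar_preimage_smul _ (by norm_num : (2 : ℝ) ≠ 0)] at h2
    have h3 : ENNReal.ofReal |((2 : ℝ) ^ Module.finrank ℝ ℂ)⁻¹| = 4⁻¹ := by
      rw [Complex.finrank_real_complex, abs_of_pos (by positivity),
        ENNReal.ofReal_inv_of_pos (by positivity)]
      norm_num
    rw [h3] at h2
    calc 4 * N t ≤ 4 * (4⁻¹ * N (4 * t)) := by gcongr
      _ = N (4 * t) := by
        rw [← mul_assoc, ENNReal.mul_inv_cancel (by norm_num) (by norm_num), one_mul]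
  have hscale' : ∀ (k : ℕ) t, 4 ^ k * N t ≤ N (4 ^ k * t) := by
    intro k
    induction k with
    | zero => intro t; simp
    | succ k ih =>
      intro t
      calc (4 : ℝ≥0∞) ^ (k + 1) * N t = 4 ^ k * (4 * N t) := by ring
        _ ≤ 4 ^ k * N (4 * t) := by gcongr; exact hscale t
        _ ≤ N (4 ^ k * (4 * t)) := ih _
        _ = _ := by rw [pow_succ, mul_assoc]
  -- Markov's inequality for the squared characteristic function at level 1/2.
  have hbase : N (1 / 2) ≤ K * ENNReal.ofReal (8 * Real.pi ^ 2) := by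
    have h1 := (meas_ge_le_lintegral_div (μ := volume)
      (f := fun ξ => ENNReal.ofReal (‖charFun μ ξ‖ ^ 2)) (ε := ENNReal.ofReal (1 / 2))
      hmeas.ennreal_ofReal.aemeasurable (by simp) (by simp))
    have h2 : N (1 / 2) ≤ volume {ξ | ENNReal.ofReal (1 / 2) ≤
        ENNReal.ofReal (‖charFun μ ξ‖ ^ 2)} := by
      refine measure_mono fun ξ hξ => ?_
      simp only [Set.mem_ofPred_eq] at hξ ⊢
      exact ENNReal.ofReal_le_ofReal (by linarith)
    refine h2.trans (h1.trans ?_)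
    rw [ENNReal.div_eq_inv_mul, ← ENNReal.ofReal_inv_of_pos (by norm_num)]
    calc _ ≤ ENNReal.ofReal (1 / 2)⁻¹ * (K * ENNReal.ofReal (4 * Real.pi ^ 2)) := by
          gcongr
          exact lintegral_charFun_sq_le μ hμ
      _ = K * (ENNReal.ofReal (1 / 2)⁻¹ * ENNReal.ofReal (4 * Real.pi ^ 2)) := by ring
      _ = _ := by
        rw [← ENNReal.ofReal_mul (by norm_num)]
        congr 2
        ring
  have hmono : ∀ {a b : ℝ}, a ≤ b → N a ≤ N b := fun hab =>
    measure_mono fun ξ hξ => by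
      simp only [Set.mem_ofPred_eq] at hξ ⊢
      exact hξ.trans hab
  -- The last scale not exceeding 1/2; its maximality gives 4⁻ᵏ < 8η.
  obtain ⟨k, hk1, hk2⟩ : ∃ k : ℕ, 4 ^ k * η ≤ 1 / 2 ∧ 1 / 2 < 4 ^ (k + 1) * η := by
    obtain ⟨k, hk1, hk2⟩ := exists_nat_pow_near (x := 1 / (2 * η)) (y := (4 : ℝ))
      (by rw [le_div_iff₀ (by positivity)]; linarith) (by norm_num)
    rw [le_div_iff₀ (by positivity)] at hk1
    rw [div_lt_iff₀ (by positivity)] at hk2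
    exact ⟨k, by linarith, by linarith⟩
  have h1 : 4 ^ k * N η ≤ K * ENNReal.ofReal (8 * Real.pi ^ 2) :=
    (hscale' k η).trans ((hmono hk1).trans hbase)
  have h2 : (1 : ℝ≥0∞) ≤ ENNReal.ofReal (8 * η) * 4 ^ k := by
    have : (4 : ℝ≥0∞) ^ k = ENNReal.ofReal (4 ^ k) := by
      rw [ENNReal.ofReal_pow (by norm_num)]; norm_num
    rw [this, ← ENNReal.ofReal_mul (by positivity), ← ENNReal.ofReal_one]
    refine ENNReal.ofReal_le_ofReal ?_
    rw [pow_succ] at hk2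
    linarith
  calc N η = 1 * N η := (one_mul _).symm
    _ ≤ ENNReal.ofReal (8 * η) * 4 ^ k * N η := by gcongr
    _ = ENNReal.ofReal (8 * η) * (4 ^ k * N η) := by ring
    _ ≤ ENNReal.ofReal (8 * η) * (K * ENNReal.ofReal (8 * Real.pi ^ 2)) := by gcongr
    _ = K * (ENNReal.ofReal (8 * η) * ENNReal.ofReal (8 * Real.pi ^ 2)) := by ring
    _ = K * (ENNReal.ofReal η * ENNReal.ofReal (64 * Real.pi ^ 2)) := by
        rw [← ENNReal.ofReal_mul (by positivity), ← ENNReal.ofReal_mul (by positivity)]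
        congr 2
        ring
    _ = _ := by ring

lemma lintegral_neg_log_Ioc : ∫⁻ t in Set.Ioc (0 : ℝ) 1, ENNReal.ofReal (-Real.log t) = 1 := by
  have hi : IntegrableOn (fun t => -Real.log t) (Set.Ioc (0 : ℝ) 1) := by
    rw [← intervalIntegrable_iff_integrableOn_Ioc_of_le zero_le_one]
    exact intervalIntegral.intervalIntegrable_log'.neg
  rw [← ofReal_integral_eq_lintegral_ofReal hi]
  · rw [← intervalIntegral.integral_of_le zero_le_one, intervalIntegral.integral_neg, integral_log]
    simp
  · filter_upwards [self_mem_ae_restrict measurableSet_Ioc] with t ht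
    exact neg_nonneg.2 (Real.log_nonpos ht.1.le ht.2)

/-- High moments of the characteristic function of a measure with density at most `K`. -/
lemma lintegral_charFun_rpow_le (μ : Measure ℂ) [IsProbabilityMeasure μ] {K : ℝ≥0∞}
    (hμ : μ ≤ K • volume) {q : ℝ} (hq : 1 ≤ q) :
    ∫⁻ ξ, ENNReal.ofReal ((‖charFun μ ξ‖ ^ 2) ^ q) ≤
      ENNReal.ofReal (1 / q) * (K * ENNReal.ofReal (72 * Real.pi ^ 2)) := by
  set h : ℂ → ℝ := fun ξ => ‖charFun μ ξ‖ ^ 2 with hh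
  have hq0 : 0 < q := by linarith
  have hmeas : Measurable h := by
    have := measurable_charFun (μ := μ)
    fun_prop
  have h0 : ∀ ξ, 0 ≤ h ξ := fun ξ => by positivity
  have h1 : ∀ ξ, h ξ ≤ 1 := fun ξ => pow_le_one₀ (norm_nonneg _) (norm_charFun_le_one ξ)
  set S : Set ℂ := {ξ | h ξ < 1 / 2} with hS
  have hSm : MeasurableSet S := measurableSet_lt hmeas measurable_const
  rw [← lintegral_add_compl _ hSm]
  -- Where h < 1/2, the power h^q is at most 2^(1-q) h, and Bernoulli's 2^q ≥ 1 + q turns this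
  -- factor into 2/q.
  have hfirst : ∫⁻ ξ in S, ENNReal.ofReal (h ξ ^ q) ≤
      ENNReal.ofReal (1 / q) * (K * ENNReal.ofReal (8 * Real.pi ^ 2)) := by
    calc ∫⁻ ξ in S, ENNReal.ofReal (h ξ ^ q)
        ≤ ∫⁻ ξ in S, ENNReal.ofReal (2 / q) * ENNReal.ofReal (h ξ) := by
          refine setLIntegral_mono' hSm fun ξ hξ => ?_
          rw [← ENNReal.ofReal_mul (by positivity)]
          refine ENNReal.ofReal_le_ofReal ?_
          rcases (h0 ξ).eq_or_lt with e | e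
          · rw [← e, Real.zero_rpow hq0.ne']; simp
          have e1 : h ξ ^ q = h ξ ^ (q - 1) * h ξ := by
            conv_lhs => rw [show q = (q - 1) + 1 by ring, Real.rpow_add e, Real.rpow_one]
          rw [e1]
          refine mul_le_mul_of_nonneg_right ?_ e.le
          calc h ξ ^ (q - 1) ≤ (1 / 2 : ℝ) ^ (q - 1) :=
                Real.rpow_le_rpow e.le (le_of_lt hξ) (by linarith)
            _ ≤ 2 / q := by
                rw [one_div, Real.inv_rpow (by norm_num), Real.rpow_sub (by norm_num),
                  Real.rpow_one, inv_div]
                gcongr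
                have := one_add_mul_self_le_rpow_one_add (s := 1) (by norm_num) hq
                norm_num at this
                linarith
      _ ≤ ∫⁻ ξ, ENNReal.ofReal (2 / q) * ENNReal.ofReal (h ξ) := setLIntegral_le_lintegral _ _
      _ = ENNReal.ofReal (2 / q) * ∫⁻ ξ, ENNReal.ofReal (h ξ) :=
          lintegral_const_mul _ hmeas.ennreal_ofReal
      _ ≤ ENNReal.ofReal (2 / q) * (K * ENNReal.ofReal (4 * Real.pi ^ 2)) := by
          gcongr
          exact lintegral_charFun_sq_le μ hμ
      _ = K * (ENNReal.ofReal (2 / q) * ENNReal.ofReal (4 * Real.pi ^ 2)) := by ring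
      _ = K * (ENNReal.ofReal (1 / q) * ENNReal.ofReal (8 * Real.pi ^ 2)) := by
          rw [← ENNReal.ofReal_mul (by positivity), ← ENNReal.ofReal_mul (by positivity)]
          congr 2
          ring
      _ = _ := by ring
  -- Layer cake: h^q > t forces 1 - h ≤ -log t / q, a set of area O(K(-log t)/q), and -log has
  -- integral 1 over (0, 1].
  have hsecond : ∫⁻ ξ in Sᶜ, ENNReal.ofReal (h ξ ^ q) ≤
      ENNReal.ofReal (1 / q) * (K * ENNReal.ofReal (64 * Real.pi ^ 2)) := by
    rw [lintegral_eq_lintegral_meas_lt (volume.restrict Sᶜ)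
      (Filter.Eventually.of_forall fun ξ => Real.rpow_nonneg (h0 ξ) q)
      (hmeas.pow_const q).aemeasurable]
    set A : ℝ≥0∞ := K * ENNReal.ofReal (64 * Real.pi ^ 2)
    have hb : ∀ t ∈ Set.Ioi (0 : ℝ), (volume.restrict Sᶜ) {ξ | t < h ξ ^ q} ≤
        (Set.Ioc (0 : ℝ) 1).indicator
          (fun t => ENNReal.ofReal (1 / q) * A * ENNReal.ofReal (-Real.log t)) t := by
      intro t ht
      have ht0 : 0 < t := ht
      by_cases ht1 : t < 1
      · have ht2 : t ∈ Set.Ioc (0 : ℝ) 1 := ⟨ht0, ht1.le⟩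
        rw [Set.indicator_of_mem ht2]
        have hlog : 0 < -Real.log t := neg_pos.2 (Real.log_neg ht0 ht1)
        set η : ℝ := min (-Real.log t / q) (1 / 2)
        have hη0 : 0 < η := lt_min (by positivity) (by norm_num)
        have hsub : {ξ | t < h ξ ^ q} ∩ Sᶜ ⊆ {ξ | 1 - ‖charFun μ ξ‖ ^ 2 ≤ η} := by
          rintro ξ ⟨hξ, hξS⟩
          simp only [Set.mem_ofPred_eq, hS, Set.mem_compl_iff, not_lt] at hξ hξS ⊢
          refine le_min ?_ (by change 1 - h ξ ≤ 1 / 2; linarith)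
          have hpos : 0 < h ξ := by linarith
          have := Real.log_lt_log ht0 hξ
          rw [Real.log_rpow hpos] at this
          rw [le_div_iff₀ hq0]
          have h3 := Real.log_le_sub_one_of_pos hpos
          change (1 - h ξ) * q ≤ _
          nlinarith
        rw [Measure.restrict_apply (measurableSet_lt measurable_const (hmeas.pow_const q))]
        calc _ ≤ volume {ξ | 1 - ‖charFun μ ξ‖ ^ 2 ≤ η} := measure_mono hsub
          _ ≤ ENNReal.ofReal η * A := volume_one_sub_charFun_le μ hμ hη0 (min_le_right _ _)
          _ ≤ ENNReal.ofReal (1 / q * (-Real.log t)) * A := by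
              gcongr
              exact (min_le_left _ _).trans (by rw [one_div_mul_eq_div])
          _ = _ := by
              rw [ENNReal.ofReal_mul (by positivity)]
              ring
      · have : {ξ | t < h ξ ^ q} = ∅ := by
          ext ξ
          simp only [Set.mem_ofPred_eq, Set.mem_empty_iff_false, iff_false, not_lt]
          exact (Real.rpow_le_one (h0 ξ) (h1 ξ) hq0.le).trans (not_lt.1 ht1)
        rw [this, measure_empty]
        exact zero_le
    calc _ ≤ ∫⁻ t in Set.Ioi (0 : ℝ), (Set.Ioc (0 : ℝ) 1).indicator
          (fun t => ENNReal.ofReal (1 / q) * A * ENNReal.ofReal (-Real.log t)) t :=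
          setLIntegral_mono' measurableSet_Ioi hb
      _ ≤ ∫⁻ t, (Set.Ioc (0 : ℝ) 1).indicator
          (fun t => ENNReal.ofReal (1 / q) * A * ENNReal.ofReal (-Real.log t)) t :=
          setLIntegral_le_lintegral _ _
      _ = ENNReal.ofReal (1 / q) * A := by
          rw [lintegral_indicator measurableSet_Ioc, lintegral_const_mul _ (by fun_prop),
            lintegral_neg_log_Ioc, mul_one]
  calc _ ≤ ENNReal.ofReal (1 / q) * (K * ENNReal.ofReal (8 * Real.pi ^ 2)) +
        ENNReal.ofReal (1 / q) * (K * ENNReal.ofReal (64 * Real.pi ^ 2)) :=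
        add_le_add hfirst hsecond
    _ = _ := by
        rw [← mul_add, ← mul_add, ← ENNReal.ofReal_add (by positivity) (by positivity)]
        congr 3
        ring

end Fourier

/-! ### Small ball estimates for linear forms in independent variables -/

section SmallBall

lemma ENNReal.prod_rpow_eq_rpow_sum {ι : Type*} (s : Finset ι) {a : ℝ≥0∞} (f : ι → ℝ)
    (hf : ∀ i ∈ s, 0 ≤ f i) : ∏ i ∈ s, a ^ (f i) = a ^ (∑ i ∈ s, f i) := by
  classical
  induction s using Finset.induction with
  | empty => simp
  | insert i s hi ih =>
    rw [Finset.prod_insert hi, Finset.sum_insert hi, ih fun j hj => hf j (by simp [hj]),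
      ENNReal.rpow_add_of_nonneg _ _ (hf i (by simp))
        (Finset.sum_nonneg fun j hj => hf j (by simp [hj]))]

/-- Fubini bound for the intersection of a set with small sections in direction `i` and a set
which is a cylinder in direction `i`. -/
lemma pi_inter_le_of_forall_section_le {ι X : Type*} [Fintype ι] [DecidableEq ι]
    [MeasurableSpace X] (μ : ι → Measure X) [∀ i, IsProbabilityMeasure (μ i)] (i : ι) {S E : Set (ι → X)}
    (hS : MeasurableSet S) (hEm : MeasurableSet E)
    (hE : ∀ x y, Function.update x i y ∈ E ↔ x ∈ E) {p : ℝ≥0∞}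
    (h : ∀ x, μ i {y | Function.update x i y ∈ S} ≤ p) :
    Measure.pi μ (S ∩ E) ≤ p * Measure.pi μ E := by
  rw [← lintegral_indicator_one (hS.inter hEm), ← lintegral_indicator_one hEm,
    ← lintegral_const_mul _ (measurable_one.indicator hEm)]
  refine lintegral_le_of_lmarginal_le {i} (measurable_one.indicator (hS.inter hEm))
    ((measurable_one.indicator hEm).const_mul p) ?_
  rw [lmarginal_singleton, lmarginal_singleton]
  intro x
  dsimp only
  have hupd : Measurable fun y => Function.update x i y := measurable_update x
  by_cases hx : x ∈ E
  · have h1 : ∀ y, (S ∩ E).indicator (1 : (ι → X) → ℝ≥0∞) (Function.update x i y) =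
        {y | Function.update x i y ∈ S}.indicator 1 y := by
      intro y
      by_cases hy : Function.update x i y ∈ S
      · have hmem : Function.update x i y ∈ S ∩ E := ⟨hy, (hE x y).2 hx⟩
        rw [Set.indicator_of_mem hmem, Set.indicator_of_mem]
        · rfl
        · exact hy
      · rw [Set.indicator_of_notMem (fun hmem => hy hmem.1), Set.indicator_of_notMem]
        exact hy
    have h2 : ∀ y, E.indicator (1 : (ι → X) → ℝ≥0∞) (Function.update x i y) = 1 := by
      intro y
      rw [Set.indicator_of_mem ((hE x y).2 hx)]
      rfl
    simp_rw [h1, h2]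
    have hSx : MeasurableSet {y | Function.update x i y ∈ S} := hupd hS
    rw [lintegral_indicator_one hSx]
    simpa using h x
  · have : ∀ y, (S ∩ E).indicator (1 : (ι → X) → ℝ≥0∞) (Function.update x i y) = 0 := by
      intro y
      rw [Set.indicator_of_notMem]
      exact fun hmem => hx ((hE x y).1 hmem.2)
    simp [this]

/-- Multiplication by v has real determinant ‖v‖² on the plane. -/
lemma lintegral_comp_mul_left_complex (F : ℂ → ℝ≥0∞) (hF : Measurable F) {v : ℂ} (hv : v ≠ 0) :
    ∫⁻ ξ, F (v * ξ) = ENNReal.ofReal (1 / ‖v‖ ^ 2) * ∫⁻ ξ, F ξ := by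
  have hdet : LinearMap.det (LinearMap.mulLeft ℝ v) = ‖v‖ ^ 2 := by
    have := Algebra.norm_complex_apply v
    rw [Algebra.norm_apply] at this
    rw [← Complex.normSq_eq_norm_sq, ← this]
    rfl
  have hne : LinearMap.det (LinearMap.mulLeft ℝ v) ≠ 0 := by
    rw [hdet]
    have := norm_pos_iff.2 hv
    positivity
  have key := Measure.map_linearMap_addHaar_eq_smul_addHaar (μ := (volume : Measure ℂ)) hne
  calc ∫⁻ ξ, F (v * ξ) = ∫⁻ ξ, F ξ ∂(Measure.map (LinearMap.mulLeft ℝ v) volume) := by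
        rw [lintegral_map hF]
        · rfl
        · exact (by fun_prop : Measurable fun ξ : ℂ => v * ξ)
    _ = _ := by
        rw [key, lintegral_smul_measure, hdet, abs_of_pos (by have := norm_pos_iff.2 hv; positivity),
          one_div, smul_eq_mul]

variable {ι : Type*} [Fintype ι]

/-- With the other coordinates frozen, x k must lie in a disc of radius r/‖v k‖, of area less than
2πr². The constant is enlarged to match the Fourier case. -/
lemma pi_ball_le_of_large_coefficient [DecidableEq ι] (μ : Measure ℂ) [IsProbabilityMeasure μ]
    {K : ℝ≥0∞} (hμ : μ ≤ K • volume) (v : ι → ℂ) (k : ι) (hk : 1 / 2 < ‖v k‖ ^ 2) (c : ℂ) {r : ℝ}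
    (hr : 0 < r) :
    Measure.pi (fun _ : ι => μ) {x | ‖∑ k, v k * x k - c‖ < r} ≤
      ENNReal.ofReal (r ^ 2) * (K * ENNReal.ofReal (144 * Real.pi ^ 2)) := by
  have hm : MeasurableSet {x : ι → ℂ | ‖∑ k, v k * x k - c‖ < r} :=
    measurableSet_lt (by fun_prop) measurable_const
  have hvk : v k ≠ 0 := fun h => by norm_num [h] at hk
  have hvk' : 0 < ‖v k‖ := norm_pos_iff.2 hvk
  have := pi_inter_le_of_forall_section_le (fun _ : ι => μ) k (S := {x | ‖∑ k, v k * x k - c‖ < r})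
    (E := Set.univ) hm MeasurableSet.univ (by simp)
    (p := ENNReal.ofReal (r ^ 2) * (K * ENNReal.ofReal (144 * Real.pi ^ 2))) ?_
  · simpa using this
  intro x
  set d : ℂ := (c - ∑ j ∈ Finset.univ.erase k, v j * x j) / v k with hd
  have hsub : {y | Function.update x k y ∈ {x : ι → ℂ | ‖∑ k, v k * x k - c‖ < r}} ⊆
      Metric.ball d (r / ‖v k‖) := by
    intro y hy
    simp only [Set.mem_ofPred_eq] at hy
    rw [← Finset.add_sum_erase _ _ (Finset.mem_univ k), Function.update_self,
      Finset.sum_congr rfl (fun j hj => by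
        rw [Function.update_of_ne (Finset.ne_of_mem_erase hj)])] at hy
    rw [Metric.mem_ball, dist_eq_norm, lt_div_iff₀ hvk', ← norm_mul]
    have e : (y - d) * v k = v k * y + ∑ j ∈ Finset.univ.erase k, v j * x j - c := by
      rw [hd]
      field_simp
      ring
    rwa [e]
  refine (measure_mono hsub).trans ((hμ _).trans ?_)
  rw [Measure.smul_apply, smul_eq_mul, Complex.volume_ball]
  have h1 : ENNReal.ofReal (r / ‖v k‖) ^ 2 ≤ ENNReal.ofReal (r ^ 2) * ENNReal.ofReal 2 := by
    rw [← ENNReal.ofReal_pow (by positivity), ← ENNReal.ofReal_mul (by positivity)]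
    refine ENNReal.ofReal_le_ofReal ?_
    rw [div_pow, div_le_iff₀ (by positivity)]
    have := sq_nonneg r
    nlinarith
  have h2 : ENNReal.ofReal 2 * (NNReal.pi : ℝ≥0∞) ≤ ENNReal.ofReal (144 * Real.pi ^ 2) := by
    have : (NNReal.pi : ℝ≥0∞) = ENNReal.ofReal Real.pi := by
      rw [← NNReal.coe_real_pi, ENNReal.ofReal_coe_nnreal]
    rw [this, ← ENNReal.ofReal_mul (by norm_num)]
    refine ENNReal.ofReal_le_ofReal ?_
    nlinarith [Real.pi_gt_three]
  calc K * (ENNReal.ofReal (r / ‖v k‖) ^ 2 * (NNReal.pi : ℝ≥0∞))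
      ≤ K * ((ENNReal.ofReal (r ^ 2) * ENNReal.ofReal 2) * (NNReal.pi : ℝ≥0∞)) := by gcongr
    _ = ENNReal.ofReal (r ^ 2) * (K * (ENNReal.ofReal 2 * (NNReal.pi : ℝ≥0∞))) := by ring
    _ ≤ _ := by gcongr

lemma charFun_map_linear (μ : Measure ℂ) [IsProbabilityMeasure μ] (v : ι → ℂ) (ξ : ℂ) :
    charFun ((Measure.pi (fun _ : ι => μ)).map (fun x => ∑ k, v k * x k)) ξ =
      ∏ k, charFun μ ((starRingEnd ℂ) (v k) * ξ) := by
  rw [charFun_apply, integral_map (Measurable.aemeasurable (by fun_prop))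
    (Continuous.aestronglyMeasurable (by fun_prop))]
  have h1 : ∀ x : ι → ℂ, Complex.exp (((inner ℝ (∑ k, v k * x k) ξ : ℝ) : ℂ) * Complex.I) =
      ∏ k, Complex.exp (((inner ℝ (x k) ((starRingEnd ℂ) (v k) * ξ) : ℝ) : ℂ) * Complex.I) := by
    intro x
    rw [← Complex.exp_sum, ← Finset.sum_mul, sum_inner, Complex.ofReal_sum]
    congr 3
    ext k
    congr 1
    simp only [Complex.inner, map_mul]
    congr 1
    ring
  simp_rw [h1]
  rw [integral_fintype_prod_eq_prod (fun k (y : ℂ) =>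
    Complex.exp (((inner ℝ y ((starRingEnd ℂ) (v k) * ξ) : ℝ) : ℂ) * Complex.I))]
  rfl

/-- Linear images, with unit coefficient vector, of i.i.d. variables with density at most `K`
have density at most a constant times `K`. -/
lemma pi_ball_le (μ : Measure ℂ) [IsProbabilityMeasure μ] {K : ℝ≥0∞} (hμ : μ ≤ K • volume)
    (v : ι → ℂ) (hv : ∑ k, ‖v k‖ ^ 2 = 1) (c : ℂ) {r : ℝ} (hr : 0 < r) :
    Measure.pi (fun _ : ι => μ) {x | ‖∑ k, v k * x k - c‖ < r} ≤
      ENNReal.ofReal (r ^ 2) * (K * ENNReal.ofReal (144 * Real.pi ^ 2)) := by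
  classical
  by_cases hlarge : ∃ k, 1 / 2 < ‖v k‖ ^ 2
  · obtain ⟨k, hk⟩ := hlarge
    exact pi_ball_le_of_large_coefficient μ hμ v k hk c hr
  push Not at hlarge
  have hmap : Measurable fun x : ι → ℂ => ∑ k, v k * x k := by fun_prop
  set ρ := (Measure.pi (fun _ : ι => μ)).map (fun x => ∑ k, v k * x k) with hρ
  have : IsProbabilityMeasure ρ := Measure.isProbabilityMeasure_map hmap.aemeasurable
  have h1 : Measure.pi (fun _ : ι => μ) {x | ‖∑ k, v k * x k - c‖ < r} =
      ρ (Metric.ball c r) := by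
    rw [hρ, Measure.map_apply hmap Metric.isOpen_ball.measurableSet]
    congr 1
    ext x
    simp [dist_eq_norm]
  rw [h1]
  refine (measure_ball_le_lintegral_charFun ρ c hr).trans ?_
  refine mul_le_mul_right ?_ _
  have hphi := measurable_charFun (μ := μ)
  set s : Finset ι := Finset.univ.filter fun k => v k ≠ 0 with hs
  have hpos : ∀ k ∈ s, 0 < ‖v k‖ := fun k hk => norm_pos_iff.2 (Finset.mem_filter.1 hk).2
  have hsum : ∑ k ∈ s, ‖v k‖ ^ 2 = 1 := by
    rw [← hv, hs, Finset.sum_filter_of_ne]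
    intro k _ hk h0
    simp [h0] at hk
  -- The exponent is chosen so that f k to the Hölder weight ‖v k‖² is exactly the k-th factor of
  -- the characteristic function.
  set f : ι → ℂ → ℝ≥0∞ := fun k ξ =>
    ENNReal.ofReal ((‖charFun μ ((starRingEnd ℂ) (v k) * ξ)‖ ^ 2) ^ (1 / (2 * ‖v k‖ ^ 2))) with hf
  have hprod : ∀ ξ, ‖charFun ρ ξ‖ₑ = ∏ k ∈ s, f k ξ ^ (‖v k‖ ^ 2) := by
    intro ξ
    rw [hρ, charFun_map_linear, ← ofReal_norm, norm_prod]
    have : ∏ k, ‖charFun μ ((starRingEnd ℂ) (v k) * ξ)‖ =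
        ∏ k ∈ s, ‖charFun μ ((starRingEnd ℂ) (v k) * ξ)‖ := by
      rw [hs, Finset.prod_filter_of_ne]
      intro k _ hk h0
      simp [h0] at hk
    rw [this, ENNReal.ofReal_prod_of_nonneg (fun _ _ => norm_nonneg _)]
    refine Finset.prod_congr rfl fun k hk => ?_
    have := hpos k hk
    rw [hf]
    dsimp only
    rw [ENNReal.ofReal_rpow_of_nonneg (by positivity) (by positivity), ← Real.rpow_mul (by positivity),
      ← Real.rpow_natCast, ← Real.rpow_mul (by positivity)]
    have e : ((2 : ℕ) : ℝ) * (1 / (2 * ‖v k‖ ^ 2) * ‖v k‖ ^ 2) = 1 := by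
      push_cast
      field_simp
    rw [e, Real.rpow_one]
  simp_rw [hprod]
  refine (ENNReal.lintegral_prod_norm_pow_le s (fun k _ => ?_) hsum
    (fun k _ => by positivity)).trans ?_
  · exact Measurable.aemeasurable (by fun_prop)
  -- The Jacobian 1/‖v k‖² cancels the moment decay 1/q = 2‖v k‖², so the bound is the same for all
  -- k. The requirement q ≥ 1 is where ‖v k‖² ≤ 1/2 enters.
  have hone : ∀ k ∈ s, ∫⁻ ξ, f k ξ ≤ K * ENNReal.ofReal (144 * Real.pi ^ 2) := by
    intro k hk
    have hk0 := hpos k hk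
    have hne : (starRingEnd ℂ) (v k) ≠ 0 := by
      simpa using (Finset.mem_filter.1 hk).2
    rw [hf]
    dsimp only
    rw [lintegral_comp_mul_left_complex (fun ζ => ENNReal.ofReal ((‖charFun μ ζ‖ ^ 2) ^
      (1 / (2 * ‖v k‖ ^ 2)))) (by fun_prop) hne]
    have hq : 1 ≤ 1 / (2 * ‖v k‖ ^ 2) := by
      rw [le_div_iff₀ (by positivity)]
      linarith [hlarge k]
    calc _ ≤ ENNReal.ofReal (1 / ‖(starRingEnd ℂ) (v k)‖ ^ 2) *
          (ENNReal.ofReal (1 / (1 / (2 * ‖v k‖ ^ 2))) *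
            (K * ENNReal.ofReal (72 * Real.pi ^ 2))) :=
          mul_le_mul_right (lintegral_charFun_rpow_le μ hμ hq) _
      _ = K * (ENNReal.ofReal (1 / ‖(starRingEnd ℂ) (v k)‖ ^ 2) *
          ENNReal.ofReal (1 / (1 / (2 * ‖v k‖ ^ 2))) * ENNReal.ofReal (72 * Real.pi ^ 2)) := by ring
      _ = _ := by
          rw [← ENNReal.ofReal_mul (by positivity), ← ENNReal.ofReal_mul (by positivity)]
          congr 2
          rw [RCLike.norm_conj]
          field_simp
          ring
  calc _ ≤ ∏ k ∈ s, (K * ENNReal.ofReal (144 * Real.pi ^ 2)) ^ (‖v k‖ ^ 2) :=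
        Finset.prod_le_prod' fun k hk => ENNReal.rpow_le_rpow (hone k hk) (by positivity)
    _ = _ := by
        rw [ENNReal.prod_rpow_eq_rpow_sum s _ (fun k _ => by positivity), hsum, ENNReal.rpow_one]

end SmallBall

/-! ### Distances from random columns to spans of other columns -/

section Columns

variable {n : ℕ}

/-- The columns `a j + t X j` of an affine image of the matrix with columns `X j`. -/
def affineColumn (a : Fin n → Fin n → ℂ) (t : ℝ) (X : Fin n → Fin n → ℂ) (j : Fin n) :
    EuclideanSpace ℂ (Fin n) :=
  WithLp.toLp 2 (a j + (t : ℂ) • X j)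

/-- The `j`-th column is within distance `r` of the span of the columns indexed by `T`. -/
def nearSpan (a : Fin n → Fin n → ℂ) (t : ℝ) (j : Fin n) (T : Finset (Fin n)) (r : ℝ) :
    Set (Fin n → Fin n → ℂ) :=
  {X | ∃ c : Fin n → ℂ,
    ‖affineColumn a t X j - ∑ k ∈ T, c k • affineColumn a t X k‖ < r}

lemma continuous_affineColumn (a : Fin n → Fin n → ℂ) (t : ℝ) (j : Fin n) :
    Continuous fun X => affineColumn a t X j := by
  unfold affineColumn
  refine (PiLp.continuous_toLp 2 _).comp ?_
  fun_prop

/-- A union of open conditions over all coefficient vectors; this gives measurability without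
measurable selection. -/
lemma isOpen_nearSpan (a : Fin n → Fin n → ℂ) (t : ℝ) (j : Fin n) (T : Finset (Fin n)) (r : ℝ) :
    IsOpen (nearSpan a t j T r) := by
  have : nearSpan a t j T r = ⋃ c : Fin n → ℂ,
      {X | ‖affineColumn a t X j - ∑ k ∈ T, c k • affineColumn a t X k‖ < r} := by
    ext X; simp [nearSpan]
  rw [this]
  refine isOpen_iUnion fun c => isOpen_lt ?_ continuous_const
  have := continuous_affineColumn a t
  fun_prop

lemma affineColumn_update_of_ne (a : Fin n → Fin n → ℂ) (t : ℝ) (X : Fin n → Fin n → ℂ)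
    {i j : Fin n} (h : j ≠ i) (y : Fin n → ℂ) :
    affineColumn a t (Function.update X i y) j = affineColumn a t X j := by
  rw [affineColumn, affineColumn, Function.update_of_ne h]

lemma sum_affineColumn_update (a : Fin n → Fin n → ℂ) (t : ℝ) (X : Fin n → Fin n → ℂ)
    {i : Fin n} {T : Finset (Fin n)} (h : i ∉ T) (y : Fin n → ℂ) (c : Fin n → ℂ) :
    ∑ k ∈ T, c k • affineColumn a t (Function.update X i y) k =
      ∑ k ∈ T, c k • affineColumn a t X k :=
  Finset.sum_congr rfl fun k hk => by
    rw [affineColumn_update_of_ne]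
    rintro rfl
    exact h hk

lemma update_mem_nearSpan_iff (a : Fin n → Fin n → ℂ) (t : ℝ) {i j : Fin n} (h : j ≠ i)
    {T : Finset (Fin n)} (hT : i ∉ T) (r : ℝ) (X : Fin n → Fin n → ℂ) (y : Fin n → ℂ) :
    Function.update X i y ∈ nearSpan a t j T r ↔ X ∈ nearSpan a t j T r := by
  simp only [nearSpan, Set.mem_ofPred_eq, affineColumn_update_of_ne a t X h,
    sum_affineColumn_update a t X hT]

/-- There is a unit vector orthogonal to fewer than `n` given vectors. -/
lemma exists_unit_orthogonal (T : Finset (Fin n)) (hT : T.card < n)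
    (Y : Fin n → EuclideanSpace ℂ (Fin n)) :
    ∃ v : EuclideanSpace ℂ (Fin n), ‖v‖ = 1 ∧ ∀ k ∈ T, inner ℂ v (Y k) = 0 := by
  classical
  set U := Submodule.span ℂ (T.image Y : Set (EuclideanSpace ℂ (Fin n)))
  have hlt : Module.finrank ℂ U < n :=
    ((finrank_span_finset_le_card _).trans Finset.card_image_le).trans_lt hT
  have hne : Uᗮ ≠ ⊥ := by
    intro h
    rw [Submodule.orthogonal_eq_bot_iff] at h
    rw [h, finrank_top, finrank_euclideanSpace_fin] at hlt
    exact lt_irrefl _ hlt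
  obtain ⟨w, hw, hw0⟩ := Submodule.exists_mem_ne_zero_of_ne_bot hne
  refine ⟨((‖w‖⁻¹ : ℝ) : ℂ) • w, ?_, fun k hk => ?_⟩
  · rw [norm_smul, Complex.norm_real, norm_inv, norm_norm, inv_mul_cancel₀ (norm_ne_zero_iff.2 hw0)]
  · rw [inner_smul_left, Submodule.inner_left_of_mem_orthogonal _ hw, mul_zero]
    exact Submodule.subset_span (by simpa using ⟨k, hk, rfl⟩)

/-- Pairing with a unit vector orthogonal to the columns in T does not exceed the distance, and it
is an affine function of y whose linear part is t times a form with unit coefficient vector. -/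
lemma section_nearSpan_le (μ : Measure ℂ) [IsProbabilityMeasure μ] {K : ℝ≥0∞}
    (hμ : μ ≤ K • volume) (a : Fin n → Fin n → ℂ) {t : ℝ} (ht : 0 < t) {j : Fin n}
    {T : Finset (Fin n)} (hj : j ∉ T) {r : ℝ} (hr : 0 < r) (X : Fin n → Fin n → ℂ) :
    Measure.pi (fun _ : Fin n => μ) {y | Function.update X j y ∈ nearSpan a t j T r} ≤
      ENNReal.ofReal ((r / t) ^ 2) * (K * ENNReal.ofReal (144 * Real.pi ^ 2)) := by
  have hcard : T.card < n := by
    have : T ⊂ Finset.univ := Finset.ssubset_univ_iff.2 fun h => hj (h ▸ Finset.mem_univ j)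
    simpa using Finset.card_lt_card this
  obtain ⟨v, hv1, hv⟩ := exists_unit_orthogonal T hcard (affineColumn a t X)
  have hsum : ∑ k, ‖(starRingEnd ℂ) (v k)‖ ^ 2 = 1 := by
    simp_rw [RCLike.norm_conj]
    rw [← EuclideanSpace.norm_sq_eq, hv1, one_pow]
  refine (measure_mono ?_).trans (pi_ball_le μ hμ (fun k => (starRingEnd ℂ) (v k)) hsum
    (-(∑ k, (starRingEnd ℂ) (v k) * a j k) / t) (div_pos hr ht))
  rintro y ⟨c, hc⟩
  rw [sum_affineColumn_update a t X hj] at hc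
  have h1 : inner ℂ v (affineColumn a t (Function.update X j y) j -
      ∑ k ∈ T, c k • affineColumn a t X k) =
      ∑ k, (starRingEnd ℂ) (v k) * a j k + t * ∑ k, (starRingEnd ℂ) (v k) * y k := by
    rw [inner_sub_right, inner_sum, Finset.sum_eq_zero, sub_zero]
    · rw [affineColumn, Function.update_self, PiLp.inner_apply, Finset.mul_sum,
        ← Finset.sum_add_distrib]
      refine Finset.sum_congr rfl fun k _ => ?_
      simp only [RCLike.inner_apply, Pi.add_apply, Pi.smul_apply, smul_eq_mul]
      ring
    · intro k hk
      rw [inner_smul_right, hv k hk, mul_zero]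
  have h2 := norm_inner_le_norm (𝕜 := ℂ) v (affineColumn a t (Function.update X j y) j -
      ∑ k ∈ T, c k • affineColumn a t X k)
  rw [h1, hv1, one_mul] at h2
  have htc : (t : ℂ) ≠ 0 := by exact_mod_cast ht.ne'
  rw [Set.mem_ofPred_eq, lt_div_iff₀ ht]
  refine lt_of_le_of_lt (le_of_eq ?_) (h2.trans_lt hc)
  rw [← Real.norm_of_nonneg ht.le, ← Complex.norm_real, ← norm_mul]
  congr 1
  rw [Complex.norm_real, Real.norm_of_nonneg ht.le]
  field_simp
  ring

/-- Joint small ball estimate for the distances of two columns. -/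
lemma pi_nearSpan_inter_nearSpan_le (μ : Measure ℂ) [IsProbabilityMeasure μ] {K : ℝ≥0∞}
    (hμ : μ ≤ K • volume) (a : Fin n → Fin n → ℂ) {t : ℝ} (ht : 0 < t) {i j : Fin n}
    (hij : i ≠ j) {r ρ : ℝ} (hr : 0 < r) (hρ : 0 < ρ) :
    Measure.pi (fun _ : Fin n => Measure.pi (fun _ : Fin n => μ))
      (nearSpan a t j (Finset.univ.erase j) r ∩
        nearSpan a t i ((Finset.univ.erase j).erase i) ρ) ≤
      ENNReal.ofReal ((r / t) ^ 2) * (K * ENNReal.ofReal (144 * Real.pi ^ 2)) *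
      (ENNReal.ofReal ((ρ / t) ^ 2) * (K * ENNReal.ofReal (144 * Real.pi ^ 2))) := by
  have hmeas := fun j T r => (isOpen_nearSpan a t j T r).measurableSet
  -- The event for column i omits column j altogether, so column j is integrated out first and
  -- column i afterwards.
  refine (pi_inter_le_of_forall_section_le _ j (hmeas _ _ _) (hmeas _ _ _)
    (fun x y => update_mem_nearSpan_iff a t hij (by simp) ρ x y)
    (section_nearSpan_le μ hμ a ht (by simp) hr)).trans ?_
  refine mul_le_mul_right ?_ _
  have := pi_inter_le_of_forall_section_le
    (fun _ : Fin n => Measure.pi (fun _ : Fin n => μ)) i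
    (hmeas i ((Finset.univ.erase j).erase i) ρ) MeasurableSet.univ (by simp)
    (section_nearSpan_le μ hμ a ht (by simp) hρ)
  simpa using this

end Columns

/-! ### From a pair of eigenvalues to two columns spanning a small area -/

section LinearAlgebra

/-- A pair of eigenvalues, counted with multiplicity, gives a two-dimensional invariant subspace
on which the endomorphism is upper triangular. -/
lemma exists_triangular_pair {V : Type*} [AddCommGroup V] [Module ℂ V] [FiniteDimensional ℂ V]
    (f : Module.End ℂ V) {a b : ℂ} (h : ({a, b} : Multiset ℂ) ≤ f.charpoly.roots) :
    ∃ (u₁ u₂ : V) (t : ℂ), u₁ ≠ 0 ∧ (∀ c : ℂ, u₂ ≠ c • u₁) ∧ f u₁ = a • u₁ ∧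
      f u₂ = b • u₂ + t • u₁ := by
  have hev : ∀ z ∈ f.charpoly.roots, f.HasEigenvalue z := fun z hz =>
    Module.End.hasEigenvalue_iff_isRoot_charpoly f z |>.2 (Polynomial.isRoot_of_mem_roots hz)
  by_cases hab : a = b
  · subst hab
    have hcount : 2 ≤ f.charpoly.rootMultiplicity a := by
      rw [← Polynomial.count_roots]
      have := Multiset.count_le_of_le a h
      simpa using this
    rw [← LinearMap.finrank_maxGenEigenspace_eq] at hcount
    -- Either the double eigenvalue has two independent eigenvectors, or some Jordan chain has
    -- length at least two and its last two nonzero vectors serve.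
    by_cases heq : f.maxGenEigenspace a ≤ f.eigenspace a
    · have h2 : 1 < Module.finrank ℂ (f.eigenspace a) :=
        lt_of_lt_of_le (by omega) (hcount.trans (Submodule.finrank_mono heq))
      obtain ⟨u₁, hu₁⟩ := Module.finrank_pos_iff_exists_ne_zero.1 (zero_lt_one.trans h2)
      obtain ⟨u₂, hu₂⟩ := exists_linearIndependent_pair_of_one_lt_finrank h2 hu₁
      rw [LinearIndependent.pair_iff] at hu₂
      refine ⟨u₁, u₂, 0, by simpa using hu₁, fun c hc => ?_, ?_, ?_⟩
      · have := hu₂ c (-1) (Subtype.ext (by simp [hc]))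
        simp at this
      · exact Module.End.mem_eigenspace_iff.1 u₁.2
      · rw [zero_smul, add_zero]
        exact Module.End.mem_eigenspace_iff.1 u₂.2
    · obtain ⟨x, hx, hx'⟩ := SetLike.not_le_iff_exists.1 heq
      rw [Module.End.mem_maxGenEigenspace] at hx
      classical
      set N : Module.End ℂ V := f - a • 1 with hN
      have hmin : ∀ m < Nat.find hx, (N ^ m) x ≠ 0 := fun m hm => Nat.find_min hx hm
      have hspec : (N ^ Nat.find hx) x = 0 := Nat.find_spec hx
      have hk : 2 ≤ Nat.find hx := by
        by_contra hlt
        apply hx'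
        rw [Module.End.mem_eigenspace_iff]
        have hN0 : N x = 0 := by
          have hcases : Nat.find hx = 0 ∨ Nat.find hx = 1 := by omega
          rcases hcases with e | e
          · rw [e] at hspec
            simp only [pow_zero, Module.End.one_apply] at hspec
            simp [hspec]
          · rwa [e, pow_one] at hspec
        simpa [hN, sub_eq_zero] using hN0
      obtain ⟨k, hk'⟩ := Nat.exists_eq_add_of_le hk
      have hu0 : N ((N ^ k) x) ≠ 0 := by
        have := hmin (k + 1) (by omega)
        rwa [pow_succ', Module.End.mul_apply] at this
      have hu1 : N (N ((N ^ k) x)) = 0 := by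
        have := hspec
        rwa [hk', show 2 + k = (k + 1) + 1 by ring, pow_succ', pow_succ', Module.End.mul_apply,
          Module.End.mul_apply] at this
      refine ⟨N ((N ^ k) x), (N ^ k) x, 1, hu0, fun c hc => ?_, ?_, ?_⟩
      · have := congrArg N hc
        rw [map_smul, hu1, smul_zero] at this
        exact hu0 this
      · have : f (N ((N ^ k) x)) - a • N ((N ^ k) x) = 0 := hu1
        exact sub_eq_zero.1 this
      · have : N ((N ^ k) x) = f ((N ^ k) x) - a • (N ^ k) x := rfl
        rw [one_smul, this]
        abel
  · obtain ⟨u₁, hu₁⟩ := (hev a (Multiset.mem_of_le h (by simp))).exists_hasEigenvector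
    obtain ⟨u₂, hu₂⟩ := (hev b (Multiset.mem_of_le h (by simp))).exists_hasEigenvector
    refine ⟨u₁, u₂, 0, hu₁.2, fun c hc => ?_, hu₁.apply_eq_smul, by simp [hu₂.apply_eq_smul]⟩
    have h1 := hu₂.apply_eq_smul
    rw [hc, map_smul, hu₁.apply_eq_smul, smul_comm, ← hc, ← sub_eq_zero, ← sub_smul,
      smul_eq_zero, sub_eq_zero] at h1
    exact h1.elim hab hu₂.2

/-- Gram–Schmidt preserves the flag, so the form stays triangular with the same diagonal; only the
off-diagonal entry changes. -/
lemma exists_orthonormal_triangular_pair {V : Type*} [NormedAddCommGroup V]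
    [InnerProductSpace ℂ V] [FiniteDimensional ℂ V]
    (f : Module.End ℂ V) {a b : ℂ} (h : ({a, b} : Multiset ℂ) ≤ f.charpoly.roots) :
    ∃ (w₁ w₂ : V) (t : ℂ), ‖w₁‖ = 1 ∧ ‖w₂‖ = 1 ∧ inner ℂ w₁ w₂ = 0 ∧ f w₁ = a • w₁ ∧
      f w₂ = b • w₂ + t • w₁ := by
  obtain ⟨u₁, u₂, t, hu₁, hu₂, hf₁, hf₂⟩ := exists_triangular_pair f h
  have hn₁ : ((‖u₁‖ : ℝ) : ℂ) ≠ 0 := by exact_mod_cast norm_ne_zero_iff.2 hu₁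
  set c : ℂ := inner ℂ u₁ u₂ / inner ℂ u₁ u₁ with hc
  set x := u₂ - c • u₁ with hx
  have hx0 : x ≠ 0 := sub_ne_zero.2 (hu₂ c)
  have hn₂ : ((‖x‖ : ℝ) : ℂ) ≠ 0 := by exact_mod_cast norm_ne_zero_iff.2 hx0
  have hin : inner ℂ u₁ x = 0 := by
    rw [hx, inner_sub_right, inner_smul_right, hc,
      div_mul_cancel₀ _ (inner_self_ne_zero.2 hu₁), sub_self]
  have hfx : f x = b • x + (t + c * b - c * a) • u₁ := by
    rw [hx, map_sub, map_smul, hf₁, hf₂]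
    module
  refine ⟨(‖u₁‖ : ℂ)⁻¹ • u₁, (‖x‖ : ℂ)⁻¹ • x, (‖x‖ : ℂ)⁻¹ * (t + c * b - c * a) * ‖u₁‖, ?_, ?_, ?_,
    ?_, ?_⟩
  · simp [norm_smul, norm_ne_zero_iff.2 hu₁]
  · simp [norm_smul, norm_ne_zero_iff.2 hx0]
  · simp [hin]
  · rw [map_smul, hf₁, smul_comm]
  · rw [map_smul, hfx, smul_add, smul_comm, smul_smul, smul_smul, smul_smul,
      mul_assoc _ (‖u₁‖ : ℂ), mul_inv_cancel₀ hn₁, mul_one]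

/-- The Gram determinant of two vectors. -/
noncomputable def gramDet {V : Type*} [NormedAddCommGroup V] [InnerProductSpace ℂ V] (x y : V) :
    ℂ :=
  inner ℂ x x * inner ℂ y y - inner ℂ x y * inner ℂ y x

section Gram

variable {V : Type*} [NormedAddCommGroup V] [InnerProductSpace ℂ V]

/-- The Gram determinant is a squared area, so a change of vectors scales it by the squared modulus
of the determinant. -/
lemma gramDet_linear_combination (x y : V) (α β γ δ : ℂ) :
    gramDet (α • x + β • y) (γ • x + δ • y) =
      ((‖α * δ - β * γ‖ ^ 2 : ℝ) : ℂ) * gramDet x y := by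
  have h : ((‖α * δ - β * γ‖ ^ 2 : ℝ) : ℂ) =
      (α * δ - β * γ) * (starRingEnd ℂ) (α * δ - β * γ) := by
    rw [Complex.mul_conj, Complex.normSq_eq_norm_sq]
  rw [h]
  simp only [gramDet, inner_add_left, inner_add_right, inner_smul_left, inner_smul_right, map_sub,
    map_mul]
  ring

lemma gramDet_eq (x y : V) :
    gramDet x y = ((‖x‖ ^ 2 * ‖y‖ ^ 2 - ‖inner ℂ x y‖ ^ 2 : ℝ) : ℂ) := by
  rw [gramDet, ← inner_conj_symm y x, Complex.mul_conj, Complex.normSq_eq_norm_sq,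
    inner_self_eq_norm_sq_to_K, inner_self_eq_norm_sq_to_K]
  push_cast
  rfl

/-- The Gram determinant is the squared product of a length and a height. -/
lemma norm_sq_mul_norm_sub_sq (p q : V) :
    ‖p‖ ^ 2 * ‖q - (inner ℂ p q / inner ℂ p p : ℂ) • p‖ ^ 2 =
      ‖p‖ ^ 2 * ‖q‖ ^ 2 - ‖inner ℂ p q‖ ^ 2 := by
  by_cases hp : p = 0
  · simp [hp]
  have hpp : inner ℂ p p ≠ 0 := inner_self_ne_zero.2 hp
  set c : ℂ := inner ℂ p q / inner ℂ p p with hc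
  have h1 := gramDet_linear_combination p q 1 0 (-c) 1
  rw [gramDet_eq, gramDet_eq] at h1
  have h2 : (1 : ℂ) • p + (0 : ℂ) • q = p := by simp
  have h3 : (-c) • p + (1 : ℂ) • q = q - c • p := by module
  rw [h2, h3] at h1
  have h4 : inner ℂ p (q - c • p) = 0 := by
    rw [inner_sub_right, inner_smul_right, hc, div_mul_cancel₀ _ hpp, sub_self]
  rw [h4] at h1
  norm_num at h1
  exact_mod_cast h1

lemma norm_sub_inner_div_smul_le (p q : V) :
    ‖q - (inner ℂ p q / inner ℂ p p : ℂ) • p‖ ≤ ‖q‖ := by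
  by_cases hp : p = 0
  · simp [hp]
  have h := norm_sq_mul_norm_sub_sq p q
  have hp' : 0 < ‖p‖ ^ 2 := by have := norm_pos_iff.2 hp; positivity
  refine (sq_le_sq₀ (norm_nonneg _) (norm_nonneg _)).1 ?_
  have := sq_nonneg ‖inner ℂ p q‖
  exact le_of_mul_le_mul_left (by linarith) hp'

end Gram

variable {n : ℕ}

/-- Two orthonormal vectors have a large two by two minor. -/
lemma exists_large_minor {w₁ w₂ : EuclideanSpace ℂ (Fin n)} (h₁ : ‖w₁‖ = 1) (h₂ : ‖w₂‖ = 1)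
    (h₁₂ : inner ℂ w₁ w₂ = 0) :
    ∃ i j, i ≠ j ∧ 1 ≤ n * ‖w₁ i * w₂ j - w₁ j * w₂ i‖ := by
  have hinner : ∑ i, w₂ i * (starRingEnd ℂ) (w₁ i) = 0 := by
    rw [← h₁₂, PiLp.inner_apply]
    rfl
  have hs₁ : ∑ i, w₁ i * (starRingEnd ℂ) (w₁ i) = 1 := by
    have := EuclideanSpace.norm_sq_eq w₁
    simp_rw [Complex.mul_conj, Complex.normSq_eq_norm_sq]
    rw [← Complex.ofReal_sum, ← this, h₁]
    simp
  have hs₂ : ∑ i, w₂ i * (starRingEnd ℂ) (w₂ i) = 1 := by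
    have := EuclideanSpace.norm_sq_eq w₂
    simp_rw [Complex.mul_conj, Complex.normSq_eq_norm_sq]
    rw [← Complex.ofReal_sum, ← this, h₂]
    simp
  -- Lagrange's identity: the Gram determinant 1 of the orthonormal pair, with each minor counted
  -- twice.
  have hsum : ∑ i, ∑ j, ‖w₁ i * w₂ j - w₁ j * w₂ i‖ ^ 2 = 2 := by
    apply Complex.ofReal_injective
    push_cast
    have : ∀ i j, ((‖w₁ i * w₂ j - w₁ j * w₂ i‖ : ℝ) : ℂ) ^ 2 =
        (w₁ i * (starRingEnd ℂ) (w₁ i)) * (w₂ j * (starRingEnd ℂ) (w₂ j)) +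
        (w₂ i * (starRingEnd ℂ) (w₂ i)) * (w₁ j * (starRingEnd ℂ) (w₁ j)) -
        (w₁ i * (starRingEnd ℂ) (w₂ i)) * (w₂ j * (starRingEnd ℂ) (w₁ j)) -
        (w₂ i * (starRingEnd ℂ) (w₁ i)) * (w₁ j * (starRingEnd ℂ) (w₂ j)) := by
      intro i j
      rw [← Complex.ofReal_pow, ← Complex.normSq_eq_norm_sq, ← Complex.mul_conj]
      simp only [map_sub, map_mul]
      ring
    simp_rw [this, Finset.sum_sub_distrib, Finset.sum_add_distrib, ← Finset.mul_sum,
      ← Finset.sum_mul, hinner, hs₁, hs₂]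
    norm_num
  have hn : 0 < n := by
    rcases Nat.eq_zero_or_pos n with rfl | h
    · simp at hsum
    · exact h
  by_contra! hcon
  have hlt : ∀ i j, ‖w₁ i * w₂ j - w₁ j * w₂ i‖ ^ 2 ≤ 1 / (n : ℝ) ^ 2 := by
    intro i j
    by_cases hij : i = j
    · subst hij
      rw [mul_comm, sub_self]
      simp
    · rw [le_div_iff₀ (by positivity), ← mul_pow]
      refine pow_le_one₀ (by positivity) ?_
      rw [mul_comm]
      exact (hcon i j hij).le
  have : ∑ i, ∑ j, ‖w₁ i * w₂ j - w₁ j * w₂ i‖ ^ 2 ≤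
      ∑ _i : Fin n, ∑ _j : Fin n, 1 / (n : ℝ) ^ 2 :=
    Finset.sum_le_sum fun i _ => Finset.sum_le_sum fun j _ => hlt i j
  rw [hsum] at this
  simp only [Finset.sum_const, Finset.card_univ, Fintype.card_fin, nsmul_eq_mul] at this
  have hn' : (n : ℝ) ≠ 0 := by positivity
  have e : (n : ℝ) * (n * (1 / (n : ℝ) ^ 2)) = 1 := by field_simp
  rw [e] at this
  norm_num at this

/-- A triangular pair of eigenvalues `a`, `b` forces two columns to span, modulo the remaining
columns, a parallelogram of small area. -/
lemma exists_columns_of_triangular_pair (Y : Fin n → EuclideanSpace ℂ (Fin n))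
    {w₁ w₂ : EuclideanSpace ℂ (Fin n)} (h₁ : ‖w₁‖ = 1) (h₂ : ‖w₂‖ = 1)
    (h₁₂ : inner ℂ w₁ w₂ = 0) {a b t : ℂ} (hY₁ : ∑ k, w₁ k • Y k = a • w₁)
    (hY₂ : ∑ k, w₂ k • Y k = b • w₂ + t • w₁) :
    ∃ i j, i ≠ j ∧ ∃ c d : Fin n → ℂ,
      ‖Y i - ∑ k ∈ (Finset.univ.erase j).erase i, c k • Y k‖ ≤ ‖Y i‖ ∧
      ‖Y j - ∑ k ∈ Finset.univ.erase j, d k • Y k‖ ≤ ‖Y j‖ ∧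
      ‖Y i - ∑ k ∈ (Finset.univ.erase j).erase i, c k • Y k‖ *
        ‖Y j - ∑ k ∈ Finset.univ.erase j, d k • Y k‖ ≤ n * (‖a‖ * ‖b‖) := by
  obtain ⟨i, j, hij, hm⟩ := exists_large_minor h₁ h₂ h₁₂
  set T : Finset (Fin n) := (Finset.univ.erase j).erase i with hT
  have hiT : i ∉ T := by simp [hT]
  have hiE : i ∈ Finset.univ.erase j := by simp [hij]
  set U := Submodule.span ℂ (Y '' (T : Set (Fin n))) with hU
  have hmemU : ∀ k ∈ T, Y k ∈ U := fun k hk => Submodule.subset_span ⟨k, hk, rfl⟩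
  have hrep : ∀ u ∈ U, ∃ c : Fin n → ℂ, ∑ k ∈ T, c k • Y k = u := by
    intro u hu
    obtain ⟨c, hc⟩ := Submodule.mem_span_image_finset_iff_exists_fun' ℂ |>.1 hu
    exact ⟨c, hc⟩
  -- P kills every column except i and j, so only the coordinates i and j of w₁ and w₂ survive in
  -- the projected relations.
  set P := Uᗮ.starProjection with hP
  have hP0 : ∀ u ∈ U, P u = 0 := fun u hu => by
    rw [hP, Submodule.starProjection_apply_eq_zero_iff]
    exact U.le_orthogonal_orthogonal hu
  have hPle : ∀ x, ‖P x‖ ≤ ‖x‖ := fun x => Submodule.norm_starProjection_apply_le _ x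
  have hPsub : ∀ x, x - P x ∈ U := fun x => by
    have := Submodule.sub_starProjection_mem_orthogonal (K := Uᗮ) x
    rwa [Submodule.orthogonal_orthogonal] at this
  set p := P (Y i) with hp
  set q := P (Y j) with hq
  have hPsum : ∀ w : EuclideanSpace ℂ (Fin n), P (∑ k, w k • Y k) = w i • p + w j • q := by
    intro w
    rw [map_sum, ← Finset.add_sum_erase _ _ (Finset.mem_univ j), ← Finset.add_sum_erase _ _ hiE,
      Finset.sum_eq_zero, add_zero, map_smul, map_smul, add_comm]
    intro k hk
    rw [map_smul, hP0 _ (hmemU k hk), smul_zero]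
  have e₁ : w₁ i • p + w₁ j • q = a • P w₁ + (0 : ℂ) • P w₂ := by
    rw [← hPsum, hY₁, map_smul, zero_smul, add_zero]
  have e₂ : w₂ i • p + w₂ j • q = t • P w₁ + b • P w₂ := by
    rw [← hPsum, hY₂, map_add, map_smul, map_smul, add_comm]
  -- The same Gram determinant computed twice: from p, q with the large minor, and from P w₁, P w₂
  -- with the triangular determinant ab, in which t disappears.
  have hgram := gramDet_linear_combination p q (w₁ i) (w₁ j) (w₂ i) (w₂ j)
  rw [e₁, e₂, gramDet_linear_combination, gramDet_eq, gramDet_eq, ← Complex.ofReal_mul,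
    ← Complex.ofReal_mul] at hgram
  have hgram' := Complex.ofReal_injective hgram
  rw [← norm_sq_mul_norm_sub_sq p q, zero_mul, sub_zero, norm_mul] at hgram'
  set z : ℂ := inner ℂ p q / inner ℂ p p with hz
  have hW : ‖P w₁‖ ^ 2 * ‖P w₂‖ ^ 2 - ‖inner ℂ (P w₁) (P w₂)‖ ^ 2 ≤ 1 := by
    have a1 : ‖P w₁‖ ^ 2 ≤ 1 := pow_le_one₀ (norm_nonneg _) ((hPle w₁).trans h₁.le)
    have a2 : ‖P w₂‖ ^ 2 ≤ 1 := pow_le_one₀ (norm_nonneg _) ((hPle w₂).trans h₂.le)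
    have := mul_le_one₀ a1 (sq_nonneg _) a2
    have := sq_nonneg ‖inner ℂ (P w₁) (P w₂)‖
    linarith
  obtain ⟨c, hc⟩ := hrep _ (hPsub (Y i))
  obtain ⟨c', hc'⟩ := hrep _ (hPsub (Y j))
  have hi_eq : Y i - ∑ k ∈ T, c k • Y k = p := by rw [hc]; abel
  -- Subtracting z • p uses column i with coefficient z and shifts the coefficients on T by -z c, so
  -- q - z • p is still column j minus a combination of all the others.
  have hj_eq : Y j - ∑ k ∈ Finset.univ.erase j,
      (if k = i then z else c' k - z * c k) • Y k = q - z • p := by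
    rw [← Finset.add_sum_erase _ _ hiE, if_pos rfl, Finset.sum_congr rfl (fun k hk => by
      rw [if_neg (Finset.ne_of_mem_erase hk)]), ← hT]
    simp_rw [sub_smul, mul_smul]
    rw [Finset.sum_sub_distrib, ← Finset.smul_sum, hc, hc']
    module
  refine ⟨i, j, hij, c, fun k => if k = i then z else c' k - z * c k, ?_, ?_, ?_⟩
  · rw [hi_eq]
    exact hPle _
  · rw [hj_eq]
    exact (norm_sub_inner_div_smul_le p q).trans (hPle _)
  · rw [hi_eq, hj_eq]
    set m := ‖w₁ i * w₂ j - w₁ j * w₂ i‖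
    have hm0 : 0 ≤ m := norm_nonneg _
    have h3 : (m * (‖p‖ * ‖q - z • p‖)) ^ 2 ≤ (‖a‖ * ‖b‖) ^ 2 := by
      calc (m * (‖p‖ * ‖q - z • p‖)) ^ 2 = m ^ 2 * (‖p‖ ^ 2 * ‖q - z • p‖ ^ 2) := by ring
        _ = _ := hgram'.symm
        _ ≤ (‖a‖ * ‖b‖) ^ 2 * 1 := by gcongr
        _ = _ := mul_one _
    have h4 : m * (‖p‖ * ‖q - z • p‖) ≤ ‖a‖ * ‖b‖ :=
      (sq_le_sq₀ (by positivity) (by positivity)).1 h3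
    calc ‖p‖ * ‖q - z • p‖ = 1 * (‖p‖ * ‖q - z • p‖) := (one_mul _).symm
      _ ≤ (n * m) * (‖p‖ * ‖q - z • p‖) := by gcongr
      _ = n * (m * (‖p‖ * ‖q - z • p‖)) := by ring
      _ ≤ _ := by gcongr

end LinearAlgebra

/-! ### Lattice discretization and dyadic decomposition -/

section EigenvalueGap

variable {n : ℕ}

/-- The columns of `A - z`. -/
def shiftedColumns (A : Matrix (Fin n) (Fin n) ℂ) (z : ℂ) (j k : Fin n) : ℂ :=
  (A - z • (1 : Matrix (Fin n) (Fin n) ℂ)) k j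

/-- The columns of `√n G`. -/
noncomputable def scaledColumns (G : Matrix (Fin n) (Fin n) ℂ) (j k : Fin n) : ℂ :=
  (Real.sqrt n : ℂ) * G k j

lemma affineColumn_shiftedColumns (hn : 0 < n) (A G : Matrix (Fin n) (Fin n) ℂ) (z : ℂ) (δ : ℝ)
    (j : Fin n) :
    affineColumn (shiftedColumns A z) (δ / Real.sqrt n) (scaledColumns G) j =
      Matrix.toEuclideanLin (A + (δ : ℂ) • G) (EuclideanSpace.single j 1) -
        z • EuclideanSpace.single j 1 := by
  have hs : (Real.sqrt n : ℂ) ≠ 0 := by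
    have : 0 < Real.sqrt n := Real.sqrt_pos.2 (by exact_mod_cast hn)
    exact_mod_cast this.ne'
  ext k
  simp only [affineColumn, shiftedColumns, scaledColumns, Matrix.toEuclideanLin,
    Pi.add_apply, Pi.smul_apply, smul_eq_mul, Matrix.sub_apply, Matrix.smul_apply, Matrix.one_apply,
    Complex.ofReal_div]
  simp
  field_simp
  ring

lemma sum_smul_affineColumn (hn : 0 < n) (A G : Matrix (Fin n) (Fin n) ℂ) (z : ℂ) (δ : ℝ)
    (w : EuclideanSpace ℂ (Fin n)) :
    ∑ k, w k • affineColumn (shiftedColumns A z) (δ / Real.sqrt n) (scaledColumns G) k =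
      Matrix.toEuclideanLin (A + (δ : ℂ) • G) w - z • w := by
  have hw : ∑ k, w k • EuclideanSpace.single k (1 : ℂ) = w := by
    simpa using (EuclideanSpace.basisFun (Fin n) ℂ).sum_repr w
  simp_rw [affineColumn_shiftedColumns hn, smul_sub, smul_comm _ z]
  rw [Finset.sum_sub_distrib, ← Finset.smul_sum, hw]
  simp_rw [← map_smul]
  rw [← map_sum, hw]

lemma norm_toEuclideanLin_le (M : Matrix (Fin n) (Fin n) ℂ) (w : EuclideanSpace ℂ (Fin n)) :
    ‖Matrix.toEuclideanLin M w‖ ≤ ‖M‖ * ‖w‖ := by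
  exact Matrix.l2_opNorm_mulVec M w

lemma charpoly_toEuclideanLin (M : Matrix (Fin n) (Fin n) ℂ) :
    LinearMap.charpoly (Matrix.toEuclideanLin M) = M.charpoly := by
  rw [Matrix.toEuclideanLin_eq_toLin_orthonormal, Matrix.charpoly_toLin]

/-- A point of the lattice `s ℤ[i]`. -/
noncomputable def latticePoint (s : ℝ) (p : ℤ × ℤ) : ℂ := ⟨s * p.1, s * p.2⟩

lemma exists_latticePoint_near {s R : ℝ} (hs : 0 < s) {a : ℂ} (ha : ‖a‖ ≤ R) :
    ∃ p ∈ Finset.Icc (-⌈R / s⌉) ⌈R / s⌉ ×ˢ Finset.Icc (-⌈R / s⌉) ⌈R / s⌉,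
      ‖a - latticePoint s p‖ ≤ 2 * s := by
  have hfl : ∀ x : ℝ, |x| ≤ R → ⌊x / s⌋ ∈ Finset.Icc (-⌈R / s⌉) ⌈R / s⌉ := by
    intro x hx
    rw [abs_le] at hx
    rw [Finset.mem_Icc]
    constructor
    · rw [Int.le_floor, Int.cast_neg, neg_le, ← neg_div]
      refine le_trans ?_ (Int.le_ceil _)
      gcongr
      linarith
    · have h1 : (⌊x / s⌋ : ℝ) ≤ x / s := Int.floor_le _
      have h2 : x / s ≤ R / s := by gcongr; exact hx.2
      exact_mod_cast h1.trans (h2.trans (Int.le_ceil _))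
  have herr : ∀ x : ℝ, |x - s * ⌊x / s⌋| ≤ s := by
    intro x
    have h1 : (⌊x / s⌋ : ℝ) ≤ x / s := Int.floor_le _
    have h2 : x / s < ⌊x / s⌋ + 1 := Int.lt_floor_add_one _
    rw [le_div_iff₀ hs] at h1
    rw [div_lt_iff₀ hs] at h2
    rw [abs_le]
    constructor <;> linarith
  refine ⟨(⌊a.re / s⌋, ⌊a.im / s⌋), Finset.mem_product.2
    ⟨hfl _ ((Complex.abs_re_le_norm a).trans ha), hfl _ ((Complex.abs_im_le_norm a).trans ha)⟩, ?_⟩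
  refine (Complex.norm_le_abs_re_add_abs_im _).trans ?_
  have h1 := herr a.re
  have h2 := herr a.im
  simp only [latticePoint, Complex.sub_re, Complex.sub_im]
  linarith

/-- If two eigenvalues of `A + δ G` are close then, after a shift by some lattice point, two
columns of the shifted matrix span a parallelogram of small area. -/
lemma exists_columns_of_eigenvalueGap_le {A G : Matrix (Fin n) (Fin n) ℂ} {δ R s : ℝ}
    (hR : 1 ≤ R) (hs : s ∈ Set.Ioc (0 : ℝ) 1) (hM : ‖A + (δ : ℂ) • G‖ ≤ R)
    (hgap : eigenvalueGap (A + (δ : ℂ) • G) ≤ ENNReal.ofReal s) :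
    0 < n ∧ ∃ p ∈ Finset.Icc (-⌈R / s⌉) ⌈R / s⌉ ×ˢ Finset.Icc (-⌈R / s⌉) ⌈R / s⌉,
      ∃ i j : Fin n, i ≠ j ∧ ∃ d₁ d₂ : ℝ, 0 ≤ d₁ ∧ 0 ≤ d₂ ∧ d₁ < 8 * R ∧ d₂ < 8 * R ∧
        d₁ * d₂ ≤ 8 * n * s ^ 2 ∧
        (∀ ρ, d₁ < ρ → scaledColumns G ∈ nearSpan (shiftedColumns A (latticePoint s p))
          (δ / Real.sqrt n) i ((Finset.univ.erase j).erase i) ρ) ∧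
        (∀ r, d₂ < r → scaledColumns G ∈ nearSpan (shiftedColumns A (latticePoint s p))
          (δ / Real.sqrt n) j (Finset.univ.erase j) r) := by
  obtain ⟨hs0, hs1⟩ := hs
  set M := A + (δ : ℂ) • G with hMdef
  -- Relaxing s to 2s makes the inequality strict, so an actual pair of eigenvalues can be extracted
  -- from the infimum.
  have hlt : eigenvalueGap M < ENNReal.ofReal (2 * s) :=
    hgap.trans_lt ((ENNReal.ofReal_lt_ofReal_iff (by linarith)).2 (by linarith))
  simp only [eigenvalueGap, iInf_lt_iff] at hlt
  obtain ⟨a, b, hab, hd⟩ := hlt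
  rw [edist_dist, ENNReal.ofReal_lt_ofReal_iff (by linarith), dist_eq_norm] at hd
  have hn : 0 < n := by
    have h1 := Multiset.card_le_card hab
    have h2 := Polynomial.card_roots' M.charpoly
    rw [Matrix.charpoly_natDegree_eq_dim, Fintype.card_fin] at h2
    simp at h1
    omega
  refine ⟨hn, ?_⟩
  rw [← charpoly_toEuclideanLin] at hab
  obtain ⟨w₁, w₂, t, h₁, h₂, h₁₂, hf₁, hf₂⟩ := exists_orthonormal_triangular_pair _ hab
  have ha : ‖a‖ ≤ R := by
    have := norm_toEuclideanLin_le M w₁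
    rw [hf₁, norm_smul, h₁, mul_one, mul_one] at this
    exact this.trans hM
  obtain ⟨p, hp, hpa⟩ := exists_latticePoint_near hs0 ha
  set z := latticePoint s p
  refine ⟨p, hp, ?_⟩
  have hz : ‖z‖ ≤ 3 * R := by
    have : z = a - (a - z) := by abel
    rw [this]
    exact (norm_sub_le _ _).trans (by linarith)
  have hpb : ‖b - z‖ ≤ 4 * s := by
    have : b - z = (a - z) - (a - b) := by abel
    rw [this]
    exact (norm_sub_le _ _).trans (by linarith)
  set Y := affineColumn (shiftedColumns A z) (δ / Real.sqrt n) (scaledColumns G)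
  -- R from M and 3R from z give 4R; the slack provides strictness.
  have hYn : ∀ k, ‖Y k‖ < 8 * R := by
    intro k
    have h3 := norm_toEuclideanLin_le M (EuclideanSpace.single k 1)
    have h4 : ‖z • EuclideanSpace.single k (1 : ℂ)‖ ≤ 3 * R := by
      rw [norm_smul]; simpa using hz
    have h5 : ‖EuclideanSpace.single k (1 : ℂ)‖ = 1 := by simp
    rw [h5, mul_one] at h3
    have h6 := norm_sub_le (Matrix.toEuclideanLin M (EuclideanSpace.single k 1))
      (z • EuclideanSpace.single k (1 : ℂ))
    have h7 : Y k = _ := affineColumn_shiftedColumns hn A G z δ k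
    rw [h7]
    linarith
  have hY₁ : ∑ k, w₁ k • Y k = (a - z) • w₁ := by
    rw [sum_smul_affineColumn hn, hf₁, sub_smul]
  have hY₂ : ∑ k, w₂ k • Y k = (b - z) • w₂ + t • w₁ := by
    rw [sum_smul_affineColumn hn, hf₂, sub_smul]
    abel
  obtain ⟨i, j, hij, c, d, hc, hd', hcd⟩ :=
    exists_columns_of_triangular_pair Y h₁ h₂ h₁₂ hY₁ hY₂
  refine ⟨i, j, hij, _, _, norm_nonneg _, norm_nonneg _, hc.trans_lt (hYn i),
    hd'.trans_lt (hYn j), hcd.trans ?_, fun ρ hρ => ⟨c, hρ⟩, fun r hr => ⟨d, hr⟩⟩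
  calc (n : ℝ) * (‖a - z‖ * ‖b - z‖) ≤ n * ((2 * s) * (4 * s)) := by gcongr
    _ = _ := by ring

/-- A dyadic scale at which a number lies. -/
lemma exists_dyadic_scale {B d : ℝ} (hd : d < B) (N : ℕ) :
    d < B / 2 ^ N ∨ ∃ k < N, B / 2 ^ (k + 1) ≤ d ∧ d < B / 2 ^ k := by
  induction N with
  | zero => left; simpa using hd
  | succ N ih =>
    rcases ih with h | ⟨k, hk, h⟩
    · by_cases h' : d < B / 2 ^ (N + 1)
      · exact Or.inl h'
      · exact Or.inr ⟨N, by omega, not_lt.1 h', h⟩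
    · exact Or.inr ⟨k, by omega, h⟩

/-- Pairs of columns whose distances to the spans of other columns have a small product. -/
def smallAreaSet (a : Fin n → Fin n → ℂ) (t B τ : ℝ) (N : ℕ) (i j : Fin n) :
    Set (Fin n → Fin n → ℂ) :=
  (⋃ k ∈ Finset.range N, nearSpan a t j (Finset.univ.erase j) (4 * τ / (B / 2 ^ k)) ∩
    nearSpan a t i ((Finset.univ.erase j).erase i) (B / 2 ^ k)) ∪
  (nearSpan a t j (Finset.univ.erase j) B ∩
    nearSpan a t i ((Finset.univ.erase j).erase i) (B / 2 ^ N))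

lemma isOpen_smallAreaSet (a : Fin n → Fin n → ℂ) (t B τ : ℝ) (N : ℕ) (i j : Fin n) :
    IsOpen (smallAreaSet a t B τ N i j) :=
  (isOpen_biUnion fun _ _ => (isOpen_nearSpan _ _ _ _ _).inter (isOpen_nearSpan _ _ _ _ _)).union
    ((isOpen_nearSpan _ _ _ _ _).inter (isOpen_nearSpan _ _ _ _ _))

/-- If ρ/2 ≤ d₁ < ρ, then d₁d₂ ≤ τ gives d₂ ≤ 2τ/ρ; the 4 in the definition makes this strict. Below
the last scale only d₂ < B is used. -/
lemma mem_smallAreaSet {a : Fin n → Fin n → ℂ} {t B τ : ℝ} (hB : 0 < B) (hτ : 0 < τ) (N : ℕ)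
    {i j : Fin n} {X : Fin n → Fin n → ℂ} {d₁ d₂ : ℝ} (h₁ : d₁ < B) (h₂ : d₂ < B)
    (h : d₁ * d₂ ≤ τ) (hd₂ : 0 ≤ d₂)
    (hX₁ : ∀ ρ, d₁ < ρ → X ∈ nearSpan a t i ((Finset.univ.erase j).erase i) ρ)
    (hX₂ : ∀ r, d₂ < r → X ∈ nearSpan a t j (Finset.univ.erase j) r) :
    X ∈ smallAreaSet a t B τ N i j := by
  rcases exists_dyadic_scale h₁ N with hd | ⟨k, hk, hk₁, hk₂⟩
  · exact Or.inr ⟨hX₂ _ h₂, hX₁ _ hd⟩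
  · refine Or.inl (Set.mem_biUnion (Finset.mem_range.2 hk) ⟨hX₂ _ ?_, hX₁ _ hk₂⟩)
    have hpos : 0 < B / 2 ^ k := by positivity
    rw [lt_div_iff₀ hpos]
    have e : B / 2 ^ k = 2 * (B / 2 ^ (k + 1)) := by
      rw [pow_succ]; field_simp
    have h3 : B / 2 ^ (k + 1) * d₂ ≤ d₁ * d₂ := by gcongr
    rw [e]
    linarith

/-- The two radii multiply to 4τ at every dyadic scale, so all N scales cost the same; the leftover
piece has product B²/2^N. -/
lemma measureReal_smallAreaSet_le (μ : Measure ℂ) [IsProbabilityMeasure μ] {K : ℝ} (hK : 0 ≤ K)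
    (hμ : μ ≤ ENNReal.ofReal K • volume) (a : Fin n → Fin n → ℂ) {t B τ : ℝ} (ht : 0 < t)
    (hB : 0 < B) (hτ : 0 < τ) (N : ℕ) {i j : Fin n} (hij : i ≠ j) :
    (Measure.pi (fun _ : Fin n => Measure.pi (fun _ : Fin n => μ))).real
      (smallAreaSet a t B τ N i j) ≤
      (K * (144 * Real.pi ^ 2)) ^ 2 / t ^ 4 * (16 * N * τ ^ 2 + B ^ 4 / 4 ^ N) := by
  set Q := Measure.pi (fun _ : Fin n => Measure.pi (fun _ : Fin n => μ))
  have hreal : ∀ r ρ : ℝ, 0 < r → 0 < ρ → Q.real (nearSpan a t j (Finset.univ.erase j) r ∩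
        nearSpan a t i ((Finset.univ.erase j).erase i) ρ) ≤
        (K * (144 * Real.pi ^ 2)) ^ 2 / t ^ 4 * (r * ρ) ^ 2 := by
    intro r ρ hr hρ
    refine ENNReal.toReal_le_of_le_ofReal (by positivity)
      ((pi_nearSpan_inter_nearSpan_le μ hμ a ht hij hr hρ).trans (le_of_eq ?_))
    rw [← ENNReal.ofReal_mul hK, ← ENNReal.ofReal_mul (by positivity),
      ← ENNReal.ofReal_mul (by positivity), ← ENNReal.ofReal_mul (by positivity)]
    congr 1
    field_simp
  refine (measureReal_union_le _ _).trans ?_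
  have h1 : Q.real (⋃ k ∈ Finset.range N,
      nearSpan a t j (Finset.univ.erase j) (4 * τ / (B / 2 ^ k)) ∩
      nearSpan a t i ((Finset.univ.erase j).erase i) (B / 2 ^ k)) ≤
      (K * (144 * Real.pi ^ 2)) ^ 2 / t ^ 4 * (16 * N * τ ^ 2) := by
    refine (measureReal_biUnion_finset_le _ _).trans ?_
    calc _ ≤ ∑ _k ∈ Finset.range N, (K * (144 * Real.pi ^ 2)) ^ 2 / t ^ 4 * (4 * τ) ^ 2 := by
          refine Finset.sum_le_sum fun k _ => ?_
          refine (hreal _ _ (by positivity) (by positivity)).trans (le_of_eq ?_)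
          rw [div_mul_cancel₀ _ (by positivity)]
      _ = _ := by
          rw [Finset.sum_const, Finset.card_range, nsmul_eq_mul]
          ring
  have h2 := hreal B (B / 2 ^ N) hB (by positivity)
  have e : (B * (B / 2 ^ N)) ^ 2 = B ^ 4 / 4 ^ N := by
    rw [show (4 : ℝ) ^ N = (2 ^ N) ^ 2 by rw [← pow_mul, mul_comm, pow_mul]; norm_num]
    field_simp
  rw [e] at h2
  rw [mul_add]
  exact add_le_add h1 h2

end EigenvalueGap

/-! ### The joint law of the scaled columns -/

section Law

variable {Ω Ω' : Type*} [MeasurableSpace Ω] [MeasurableSpace Ω'] {n : ℕ}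

lemma HasDensityBoundedBy.nonneg {X : Ω → ℂ} {P : Measure Ω} {K : ℝ}
    (h : HasDensityBoundedBy X P K) : 0 ≤ K := by
  obtain ⟨-, f, -, hf, -⟩ := h
  exact (hf 0).1.trans (hf 0).2

lemma HasDensityBoundedBy.map_le {X : Ω → ℂ} {P : Measure Ω} {K : ℝ}
    (h : HasDensityBoundedBy X P K) : P.map X ≤ ENNReal.ofReal K • volume := by
  obtain ⟨-, f, -, hf, hmap⟩ := h
  rw [hmap, ← withDensity_const]
  exact withDensity_mono (Filter.Eventually.of_forall fun z => ENNReal.ofReal_le_ofReal (hf z).2)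

lemma IsNormalizedIIDMatrix.aemeasurable_scaledColumns {P : Measure Ω} {P' : Measure Ω'}
    {G : Ω → Matrix (Fin n) (Fin n) ℂ} {ξ : Ω' → ℂ} (h : IsNormalizedIIDMatrix G P ξ P') :
    AEMeasurable (fun ω => scaledColumns (G ω)) P :=
  aemeasurable_pi_lambda _ fun j => aemeasurable_pi_lambda _ fun k =>
    (h.2 (k, j)).aemeasurable_fst

/-- Independence is indexed by (row, column); swapping the pair and currying groups the entries by
columns. -/
lemma IsNormalizedIIDMatrix.map_scaledColumns {P : Measure Ω} [IsProbabilityMeasure P]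
    {P' : Measure Ω'} [IsProbabilityMeasure P'] {G : Ω → Matrix (Fin n) (Fin n) ℂ} {ξ : Ω' → ℂ}
    (h : IsNormalizedIIDMatrix G P ξ P') (hξ : AEMeasurable ξ P') :
    P.map (fun ω => scaledColumns (G ω)) =
      Measure.pi (fun _ : Fin n => Measure.pi (fun _ : Fin n => P'.map ξ)) := by
  have : IsProbabilityMeasure (P'.map ξ) :=
    Measure.isProbabilityMeasure_map hξ
  have hind := h.1.precomp (g := Prod.swap) Prod.swap_injective
  have hmap := (iIndepFun_iff_map_fun_eq_pi_map
    (fun p => (h.2 (Prod.swap p)).aemeasurable_fst)).1 hind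
  have hlaw : ∀ p : Fin n × Fin n, P.map ((fun (p : Fin n × Fin n) (ω : Ω) =>
      (Real.sqrt n : ℂ) * G ω p.1 p.2) (Prod.swap p)) = P'.map ξ := fun p =>
    (h.2 (Prod.swap p)).map_eq
  have hcurry := Measure.infinitePi_map_curry (fun _ _ : Fin n => P'.map ξ)
  simp only [Measure.infinitePi_eq_pi] at hcurry
  rw [← hcurry]
  have hpi : (Measure.pi fun _ : Fin n × Fin n => P'.map ξ) =
      P.map (fun ω p => (Real.sqrt n : ℂ) * G ω p.2 p.1) := by
    rw [← funext hlaw]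
    exact hmap.symm
  rw [hpi, AEMeasurable.map_map_of_aemeasurable (MeasurableEquiv.measurable _).aemeasurable]
  · rfl
  · exact aemeasurable_pi_lambda _ fun p => (h.2 (Prod.swap p)).aemeasurable_fst

end Law

/-! ### The union bound and the theorem -/

/-- Arithmetic of the union bound over lattice points, pairs of columns and dyadic scales. -/
lemma union_bound_arithmetic {R s δ κ : ℝ} {n : ℕ} (hn : 0 < n) (hR : 1 ≤ R)
    (hs : s ∈ Set.Ioc (0 : ℝ) 1) (hδ : 0 < δ) :
    ((2 * (⌈R / s⌉ : ℝ) + 1) ^ 2) * ((n : ℝ) ^ 2 *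
      (κ ^ 2 / (δ / Real.sqrt n) ^ 4 * (16 * (⌈2 * Real.logb 2 (R / s)⌉₊ : ℝ) *
        (8 * n * s ^ 2) ^ 2 + (8 * R) ^ 4 / 4 ^ ⌈2 * Real.logb 2 (R / s)⌉₊))) ≤
      153600 * Real.logb 2 (2 * R / s) * R ^ 2 * κ ^ 2 * (n : ℝ) ^ 4 * n ^ 2 * (s ^ 2 / δ ^ 4) := by
  obtain ⟨hs0, hs1⟩ := hs
  have hn1 : (1 : ℝ) ≤ n := by exact_mod_cast hn
  have hRs : 1 ≤ R / s := by rw [le_div_iff₀ hs0]; linarith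
  have hRs0 : 0 < R / s := by linarith
  set L := Real.logb 2 (2 * R / s) with hL
  set N := ⌈2 * Real.logb 2 (R / s)⌉₊ with hN
  have hlog0 : 0 ≤ Real.logb 2 (R / s) := Real.logb_nonneg (by norm_num) hRs
  have hLeq : L = 1 + Real.logb 2 (R / s) := by
    rw [hL, mul_div_assoc, Real.logb_mul (by norm_num) hRs0.ne', Real.logb_self_eq_one (by norm_num)]
  have hNL : (N : ℝ) ≤ 2 * L := by
    have := Nat.ceil_lt_add_one (show 0 ≤ 2 * Real.logb 2 (R / s) by positivity)
    rw [← hN] at this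
    linarith
  -- N is chosen for this: the leftover dyadic piece becomes O(s⁴), comparable to the others.
  have hpow : (R / s) ^ 4 ≤ 4 ^ N := by
    have h1 : (R / s) ^ 2 ≤ 2 ^ N := by
      have h2 : (2 : ℝ) ^ (2 * Real.logb 2 (R / s)) = (R / s) ^ 2 := by
        rw [mul_comm, Real.rpow_mul (by norm_num), Real.rpow_logb (by norm_num) (by norm_num) hRs0]
        norm_num
      rw [← h2, ← Real.rpow_natCast]
      exact Real.rpow_le_rpow_of_exponent_le (by norm_num) (Nat.le_ceil _)
    calc (R / s) ^ 4 = ((R / s) ^ 2) ^ 2 := by ring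
      _ ≤ (2 ^ N) ^ 2 := by gcongr
      _ = 4 ^ N := by rw [← pow_mul, mul_comm, pow_mul]; norm_num
  have hm : 2 * (⌈R / s⌉ : ℝ) + 1 ≤ 5 * (R / s) := by
    have := Int.ceil_lt_add_one (R / s)
    linarith
  have hm0 : 0 ≤ 2 * (⌈R / s⌉ : ℝ) + 1 := by
    have := Int.le_ceil (R / s)
    linarith
  have hsqrt : Real.sqrt n ^ 4 = (n : ℝ) ^ 2 := by
    rw [show Real.sqrt n ^ 4 = (Real.sqrt n ^ 2) ^ 2 by ring, Real.sq_sqrt (by positivity)]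
  have hlast : (8 * R) ^ 4 / 4 ^ N ≤ 4096 * s ^ 4 := by
    rw [div_le_iff₀ (by positivity)]
    calc (8 * R) ^ 4 = 4096 * s ^ 4 * (R / s) ^ 4 := by field_simp; ring
      _ ≤ _ := by gcongr
  have hL1 : 1 ≤ L := by linarith
  have hbr : 16 * (N : ℝ) * (8 * n * s ^ 2) ^ 2 + (8 * R) ^ 4 / 4 ^ N ≤
      6144 * L * n ^ 2 * s ^ 4 := by
    have h1 : 16 * (N : ℝ) * (8 * n * s ^ 2) ^ 2 ≤ 16 * (2 * L) * (8 * n * s ^ 2) ^ 2 := by gcongr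
    have h2 : 4096 * s ^ 4 ≤ 4096 * L * n ^ 2 * s ^ 4 := by
      have : 1 ≤ L * (n : ℝ) ^ 2 := one_le_mul_of_one_le_of_one_le hL1 (one_le_pow₀ hn1)
      have h4 : 0 < s ^ 4 := by positivity
      nlinarith
    have e : 16 * (2 * L) * (8 * (n : ℝ) * s ^ 2) ^ 2 = 2048 * L * n ^ 2 * s ^ 4 := by ring
    linarith
  -- Here 153600 = 25 · 6144. The factor n⁶ collects n² pairs, n² from (δ/√n)⁻⁴ and n² from the
  -- squared area; s⁴ loses s² to the lattice count.
  calc _ ≤ (5 * (R / s)) ^ 2 * ((n : ℝ) ^ 2 *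
      (κ ^ 2 / (δ / Real.sqrt n) ^ 4 * (6144 * L * n ^ 2 * s ^ 4))) := by gcongr
    _ = _ := by
      rw [div_pow δ, hsqrt]
      field_simp
      ring

theorem mainTheorem7 :
    ∃ c : ℝ, 0 < c ∧
      ∀ {Ω Ω' : Type*} [MeasurableSpace Ω] [MeasurableSpace Ω']
        (P : Measure Ω) [IsProbabilityMeasure P] (P' : Measure Ω') [IsProbabilityMeasure P']
        (ξ : Ω' → ℂ) (K : ℝ) (_hsub : IsSubGaussian ξ P') (_hdens : HasDensityBoundedBy ξ P' K)
        (n : ℕ) (G : Ω → Matrix (Fin n) (Fin n) ℂ) (_hG : IsNormalizedIIDMatrix G P ξ P')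
        (A : Matrix (Fin n) (Fin n) ℂ) (_hA : ‖A‖ ≤ 1)
        (δ : ℝ) (_hδ : δ ∈ Set.Ioo (0 : ℝ) 1)
        (K' : ℝ) (_hK' : 0 ≤ K') (s : ℝ) (_hs : s ∈ Set.Ioc (0 : ℝ) 1),
        P.real {ω | ‖G ω‖ ≤ K' ∧
            eigenvalueGap (A + (δ : ℂ) • G ω) ≤ ENNReal.ofReal s} ≤
          c * Real.logb 2 (2 * (1 + δ * K') / s) * (1 + δ * K') ^ 2 * K ^ 2 * (n : ℝ) ^ 6 *
            (s ^ 2 / δ ^ 4) := by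
  refine ⟨153600 * (144 * Real.pi ^ 2) ^ 2, by positivity, ?_⟩
  intro Ω Ω' _ _ P _ P' _ ξ K _ hdens n G hG A hA δ hδ K' hK' s hs
  obtain ⟨hδ0, -⟩ := hδ
  have hs0 := hs.1
  set R := 1 + δ * K' with hRdef
  have hR : 1 ≤ R := by
    have : 0 ≤ δ * K' := by positivity
    linarith
  set I : Finset ℤ := Finset.Icc (-⌈R / s⌉) ⌈R / s⌉ with hI
  set N := ⌈2 * Real.logb 2 (R / s)⌉₊ with hN
  set S : ℤ × ℤ → Fin n × Fin n → Set (Fin n → Fin n → ℂ) := fun p q =>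
    if q.1 = q.2 then ∅ else
      smallAreaSet (shiftedColumns A (latticePoint s p)) (δ / Real.sqrt n) (8 * R)
        (8 * n * s ^ 2) N q.1 q.2 with hS
  have hmem : ∀ ω, ‖G ω‖ ≤ K' ∧ eigenvalueGap (A + (δ : ℂ) • G ω) ≤ ENNReal.ofReal s →
      0 < n ∧ scaledColumns (G ω) ∈ ⋃ p ∈ I ×ˢ I, ⋃ q ∈ Finset.univ, S p q := by
    rintro ω ⟨hGω, hgap⟩
    have hM : ‖A + (δ : ℂ) • G ω‖ ≤ R := by
      refine (norm_add_le _ _).trans (add_le_add hA ?_)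
      rw [norm_smul, Complex.norm_real, Real.norm_of_nonneg hδ0.le]
      gcongr
    obtain ⟨hn, p, hp, i, j, hij, d₁, d₂, -, hd₂, h₁, h₂, h, hX₁, hX₂⟩ :=
      exists_columns_of_eigenvalueGap_le hR hs hM hgap
    refine ⟨hn, Set.mem_biUnion hp (Set.mem_biUnion (Finset.mem_univ (i, j)) ?_)⟩
    rw [hS]
    simp only [if_neg hij]
    exact mem_smallAreaSet (by positivity) (by positivity) N h₁ h₂ h hd₂ hX₁ hX₂
  have hL : 0 ≤ Real.logb 2 (2 * R / s) :=
    Real.logb_nonneg (by norm_num) (by rw [le_div_iff₀ hs0]; linarith [hs.2])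
  -- For n = 0 there are no eigenvalues and the event is empty; otherwise δ/√n is positive, as the
  -- column estimates require.
  rcases Nat.eq_zero_or_pos n with hn | hn
  · have : {ω | ‖G ω‖ ≤ K' ∧ eigenvalueGap (A + (δ : ℂ) • G ω) ≤ ENNReal.ofReal s} = ∅ := by
      ext ω
      simp only [Set.mem_ofPred_eq, Set.mem_empty_iff_false, iff_false]
      exact fun hω => absurd (hmem ω hω).1 (by omega)
    rw [this, measureReal_empty]
    positivity
  have hξ := hdens.1
  have : IsProbabilityMeasure (P'.map ξ) := Measure.isProbabilityMeasure_map hξ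
  set Q := Measure.pi (fun _ : Fin n => Measure.pi (fun _ : Fin n => P'.map ξ)) with hQ
  have hSopen : ∀ p q, IsOpen (S p q) := by
    intro p q
    rw [hS]
    dsimp only
    split_ifs
    · exact isOpen_empty
    · exact isOpen_smallAreaSet _ _ _ _ _ _ _
  set W := ⋃ p ∈ I ×ˢ I, ⋃ q ∈ (Finset.univ : Finset (Fin n × Fin n)), S p q with hW
  have hWm : MeasurableSet W :=
    (isOpen_biUnion fun p _ => isOpen_biUnion fun q _ => hSopen p q).measurableSet
  have hPQ : P.real {ω | ‖G ω‖ ≤ K' ∧ eigenvalueGap (A + (δ : ℂ) • G ω) ≤ ENNReal.ofReal s} ≤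
      Q.real W := by
    rw [hQ, ← hG.map_scaledColumns hξ,
      map_measureReal_apply_of_aemeasurable hG.aemeasurable_scaledColumns hWm]
    exact measureReal_mono fun ω hω => (hmem ω hω).2
  have hsqrt : 0 < Real.sqrt n := Real.sqrt_pos.2 (by exact_mod_cast hn)
  set β := (K * (144 * Real.pi ^ 2)) ^ 2 / (δ / Real.sqrt n) ^ 4 * (16 * (N : ℝ) *
    (8 * n * s ^ 2) ^ 2 + (8 * R) ^ 4 / 4 ^ N) with hβ
  have hSle : ∀ p q, Q.real (S p q) ≤ β := by
    intro p q
    rw [hS]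
    dsimp only
    split_ifs with hq
    · rw [measureReal_empty]
      positivity
    · exact measureReal_smallAreaSet_le _ hdens.nonneg hdens.map_le _ (by positivity)
        (by positivity) (by positivity) N hq
  have hcard : (((I ×ˢ I).card : ℕ) : ℝ) = (2 * (⌈R / s⌉ : ℝ) + 1) ^ 2 := by
    have h0 : 0 ≤ ⌈R / s⌉ := Int.ceil_nonneg (by positivity)
    have h1 : ((I.card : ℕ) : ℤ) = 2 * ⌈R / s⌉ + 1 := by
      rw [hI, Int.card_Icc, Int.toNat_of_nonneg (by omega)]
      ring
    have h2 : ((I.card : ℕ) : ℝ) = 2 * (⌈R / s⌉ : ℝ) + 1 := by exact_mod_cast h1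
    rw [Finset.card_product, Nat.cast_mul, h2]
    ring
  have hQW : Q.real W ≤ (2 * (⌈R / s⌉ : ℝ) + 1) ^ 2 * ((n : ℝ) ^ 2 * β) := by
    calc Q.real W ≤ ∑ _p ∈ I ×ˢ I, ∑ _q : Fin n × Fin n, β := by
          refine (measureReal_biUnion_finset_le _ _).trans (Finset.sum_le_sum fun p _ => ?_)
          exact (measureReal_biUnion_finset_le _ _).trans (Finset.sum_le_sum fun q _ => hSle p q)
      _ = _ := by
          simp only [Finset.sum_const, nsmul_eq_mul, Finset.card_univ, Fintype.card_prod,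
            Fintype.card_fin, Nat.cast_mul]
          rw [hcard]
          ring
  refine hPQ.trans (hQW.trans ((union_bound_arithmetic hn hR hs hδ0).trans (le_of_eq ?_)))
  ring
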